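/- Let $r\in\mathbb{N}$ and let $d_i,a_i,b_i>0$ ($i=1,2$) be real numbers with $a_1<1$ and $a_2+b_2<1$. For $\lambda\ge 0$ and $y\in\mathbb{N}$ put $$F(\lambda,y)=\begin{cases} d_1+a_1\lambda+b_1y, & y\le r,\\ d_2+a_2\lambda+b_2y, & y>r.\end{cases}$$ The self-excited threshold Poisson autoregression is the model in which $\lambda_t=F(\lambda_{t-1},Y_{t-1})$ and, given the past $\mathcal{F}_{t-1}=\sigma(Y_s:\ s\le t-1)$, the count $Y_t$ has the Poisson distribution with mean $\lambda_t$. Accordingly, the joint process $(\lambda_t,Y_t)$ is a Markov chain on $[0,\infty)\times\mathbb{N}$: from $(\lambda,y)$ it moves to $(\lambda',Y')$ with $\lambda'=F(\lambda,y)$ and $Y'\sim\mathrm{Poisson}(\lambda')$. There is a probability measure $\pi$ on $[0,\infty)\times\mathbb{N}$, invariant for this chain, such that: 1. (Stability.) For every initial distribution $\nu$ on $[0,\infty)\times\mathbb{N}$, the chain $(\lambda_t,Y_t)_{t\ge 0}$ started from $\nu$ satisfies, almost surely, $$\frac{1}{n+1}\sum_{t=0}^{n}\delta_{(\lambda_t,Y_t)}\longrightarrow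 \pi\quad\text{weakly as } n\to\infty.$$ The same holds for $(\lambda_t,Y_t)_{t\ge 0}$ whenever $(\lambda_t,Y_t)_{t\in\mathbb{Z}}$ is a process indexed by $\mathbb{Z}$ that follows the model. 2. (Moments.) The counts have finite moments of all orders: $\int y^s\,d\pi(\lambda,y)<\infty$ for every $s>0$. Moreover $E(Y_t^s)<\infty$ for all $s>0$ and all $t$, both for every process indexed by $\mathbb{Z}$ that follows the model and for which the law of $(\lambda_t,Y_t)$ does not depend on $t$, and for the chain $(\lambda_t,Y_t)_{t\ge0}$ started from any distribution under which $\lambda_0$ and $Y_0$ have finite moments of all orders (in particular, from fixed initial values). -/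

import Mathlib

open MeasureTheory ProbabilityTheory Filter Topology
open scoped NNReal ENNReal

/-! ### Markov chains and stability -/

/-- `X` is a (time-homogeneous) Markov chain on `(Ω, P)` with transition kernel `κ` and initial
distribution `ν`: given `X 0, …, X n`, the conditional law of `X (n + 1)` is `κ (X n)`. -/
structure IsMarkovChain {E : Type*} [MeasurableSpace E] {Ω : Type*} [MeasurableSpace Ω]
    (κ : Kernel E E) (ν : Measure E) (P : Measure Ω) (X : ℕ → Ω → E) : Prop where
  measurable : ∀ n, Measurable (X n)
  initial : P.map (X 0) = ν
  transition : ∀ (n : ℕ) (A : Set E), MeasurableSet A →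
    P⟦X (n + 1) ⁻¹' A | ⨆ i : Fin (n + 1), MeasurableSpace.comap (X i) inferInstance⟧
      =ᵐ[P] fun ω => (κ (X n ω)).real A

/-- The empirical distribution `(1 / (n + 1)) ∑_{t = 0}^{n} δ_{x t}` of a sequence. -/
noncomputable def empiricalDistribution {E : Type*} [MeasurableSpace E] (x : ℕ → E) (n : ℕ) :
    ProbabilityMeasure E :=
  ⟨((n : ℝ≥0∞) + 1)⁻¹ • ∑ t ∈ Finset.range (n + 1), Measure.dirac (x t), ⟨by
    simp [Measure.finsetSum_apply, ENNReal.inv_mul_cancel]⟩⟩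

/-- The random sequence `X` is stable with stationary distribution `μ`: almost surely, the
empirical distributions of `X` converge weakly to `μ`. -/
def IsStableSequence {E : Type*} [MetricSpace E] [MeasurableSpace E] [BorelSpace E]
    {Ω : Type*} [MeasurableSpace Ω] (P : Measure Ω) (X : ℕ → Ω → E)
    (μ : ProbabilityMeasure E) : Prop :=
  ∀ᵐ ω ∂P, Tendsto (fun n => empiricalDistribution (fun t => X t ω) n) atTop (𝓝 μ)

/-- The Markov chain with transition kernel `κ` is stable with stationary distribution `μ`: for
every initial distribution `ν`, every chain with kernel `κ` started from `ν` is a stable sequence,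
with the same stationary distribution `μ`. -/
def IsStableChain.{u, v} {E : Type v} [MetricSpace E] [MeasurableSpace E] [BorelSpace E]
    (κ : Kernel E E) (μ : ProbabilityMeasure E) : Prop :=
  ∀ (ν : Measure E) [IsProbabilityMeasure ν] (Ω : Type u) [MeasurableSpace Ω]
    (P : Measure Ω) [IsProbabilityMeasure P] (X : ℕ → Ω → E),
    IsMarkovChain κ ν P X → IsStableSequence P X μ

/-! ### The self-excited threshold Poisson autoregression -/

/-- Parameters of the two-regime model: threshold `r` and positive coefficients
`(d₁, a₁, b₁)` (lower regime) and `(d₂, a₂, b₂)` (upper regime). -/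
structure SetparParams where
  r : ℕ
  d₁ : ℝ≥0
  a₁ : ℝ≥0
  b₁ : ℝ≥0
  d₂ : ℝ≥0
  a₂ : ℝ≥0
  b₂ : ℝ≥0
  d₁_pos : 0 < d₁
  a₁_pos : 0 < a₁
  b₁_pos : 0 < b₁
  d₂_pos : 0 < d₂
  a₂_pos : 0 < a₂
  b₂_pos : 0 < b₂

namespace SetparParams

/-- The next intensity, as a function of the current intensity `l` and the current count `y`. -/
noncomputable def nextIntensity (θ : SetparParams) (l : ℝ≥0) (y : ℕ) : ℝ≥0 :=
  if y ≤ θ.r then θ.d₁ + θ.a₁ * l + θ.b₁ * y else θ.d₂ + θ.a₂ * l + θ.b₂ * y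

theorem measurable_nextIntensity (θ : SetparParams) :
    Measurable fun x : ℝ≥0 × ℕ => θ.nextIntensity x.1 x.2 := by
  refine measurable_from_prod_countable_left fun y => ?_
  by_cases h : y ≤ θ.r
  · simp only [nextIntensity, h, if_true]; fun_prop
  · simp only [nextIntensity, h, if_false]; fun_prop

end SetparParams

theorem measurable_poissonMeasure : Measurable poissonMeasure := by
  refine Measure.measurable_of_measurable_coe _ fun s hs => ?_
  have h : (fun l : ℝ≥0 => poissonMeasure l s) = fun l : ℝ≥0 =>
      ∑' n : ℕ, ENNReal.ofReal (Real.exp (-l) * l ^ n / n.factorial) *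
        (Measure.dirac n : Measure ℕ) s := by
    funext l
    simp [poissonMeasure, Measure.sum_apply _ hs]
  rw [h]
  refine Measurable.tsum fun n => ?_
  fun_prop

/-- The Poisson distribution as a kernel in its mean. -/
noncomputable def poissonMeanKernel : Kernel ℝ≥0 ℕ where
  toFun := poissonMeasure
  measurable' := measurable_poissonMeasure

instance : IsMarkovKernel poissonMeanKernel :=
  ⟨fun l => inferInstanceAs (IsProbabilityMeasure (poissonMeasure l))⟩

namespace SetparParams

/-- Transition kernel of the joint chain `(λ_t, Y_t)`: from `(l, y)` the intensity moves to
`l' = nextIntensity l y`, and the new count is Poisson with mean `l'`. -/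
noncomputable def jointKernel (θ : SetparParams) : Kernel (ℝ≥0 × ℕ) (ℝ≥0 × ℕ) :=
  (Kernel.id ×ₖ poissonMeanKernel).comap (fun x => θ.nextIntensity x.1 x.2) θ.measurable_nextIntensity

theorem jointKernel_apply (θ : SetparParams) (x : ℝ≥0 × ℕ) :
    θ.jointKernel x = (Measure.dirac (θ.nextIntensity x.1 x.2)).prod
      (poissonMeasure (θ.nextIntensity x.1 x.2)) := by
  rw [jointKernel, Kernel.comap_apply, Kernel.prod_apply, Kernel.id_apply]
  rfl

instance (θ : SetparParams) : IsMarkovKernel θ.jointKernel := by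
  unfold jointKernel; infer_instance

end SetparParams

/-- `(lam, Y)`, indexed by `ℤ`, follows the SETPAR model with parameters `θ`: given
`σ(Y s, s ≤ t - 1)` the count `Y t` is Poisson with mean `lam t`, and the intensities follow the
two-regime recursion. -/
structure IsSetpar {Ω : Type*} [MeasurableSpace Ω] (θ : SetparParams) (P : Measure Ω)
    (lam : ℤ → Ω → ℝ≥0) (Y : ℤ → Ω → ℕ) : Prop where
  measurable_intensity : ∀ t, Measurable (lam t)
  measurable_count : ∀ t, Measurable (Y t)
  conditional_law : ∀ (t : ℤ) (n : ℕ),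
    P⟦Y t ⁻¹' {n} | ⨆ s : {s : ℤ // s ≤ t - 1}, MeasurableSpace.comap (Y s) inferInstance⟧
      =ᵐ[P] fun ω => (poissonMeasure (lam t ω)).real {n}
  recursion : ∀ t, ∀ᵐ ω ∂P, lam t ω = θ.nextIntensity (lam (t - 1) ω) (Y (t - 1) ω)

universe u

/-! The chain is not irreducible in any convenient sense, and the threshold makes the recursion
expanding for some pairs of states, so stability comes from a coupling that contracts a suitable
distance (a weak form of Harris' theorem).

Take two intensities `u ≤ u + w`. Couple the counts as `Y` and `Y + Z` with independent `Y ~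
Poisson(u)`, `Z ~ Poisson(w)`. With probability `exp (-w)` the counts agree. Then both copies use
the same regime, and the intensities approach by the factor `a = max a₁ a₂ < 1`. Otherwise nothing
is known, but the bounded distance `1 - exp (-K |u - v|)` costs at most 1. Its expectation is at
most `1 - exp (-(1 + K a) w)`, and `1 + K a < K` once `K` is large. This contracts strictly as long
as `w` stays bounded (`lintegral_coupled_bounded_le`).

Large `w` is handled by the Lyapunov function `exp (ε λ)`. In the lower regime the count is at most
`r`, so only `a₁ < 1` matters; in the upper regime the Poisson moment generating function and `a₂ +
b₂ < 1` give the drift (`exists_exp_drift`). Cauchy–Schwarz combines both effects into a contraction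
of `intensityDist` (`exists_coupling_contraction`).

Consequently iterated averages of bounded Lipschitz functions forget the starting point
geometrically. Tightness and continuity of these averages give an invariant law with an exponential
moment. Geometric forgetting makes correlations along the chain summable, so a second-moment strong
law holds for each bounded Lipschitz function, and countably many of them determine weak convergence
(`isStableChain_of_geometric`).

A process indexed by `ℤ` reduces to this: `P(Y_t = 0 | past) = exp (-λ_t)` shows that the intensity
is almost surely a function of the past counts, hence the pairs form a Markov chain. Moments under
the invariant law come from its exponential moment; moments at a fixed time from a polynomial bound
for a single transition. -/

/-! ### Strong law from decaying correlations, and countable tests for weak convergence -/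

/-- Bounded random variables whose correlations decay geometrically satisfy the strong law. -/
theorem ae_tendsto_average_zero_of_correlation {Ω : Type*} [MeasurableSpace Ω] (μ : Measure Ω)
    [IsFiniteMeasure μ] {Z : ℕ → Ω → ℝ} (hm : ∀ n, Measurable (Z n)) {B : ℝ}
    (hB : ∀ n ω, |Z n ω| ≤ B) {C α : ℝ} (hC : 0 ≤ C) (hα0 : 0 ≤ α) (hα1 : α < 1)
    (hcov : ∀ s m, |∫ ω, Z s ω * Z (s + m) ω ∂μ| ≤ C * α ^ m) :
    ∀ᵐ ω ∂μ, Tendsto (fun n : ℕ => (∑ t ∈ Finset.range n, Z t ω) / n) atTop (𝓝 0) := by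
  set S : ℕ → Ω → ℝ := fun n ω => ∑ t ∈ Finset.range n, Z t ω with hS
  have hSm : ∀ n, Measurable (S n) := fun n => Finset.measurable_fun_sum _ fun i _ => hm i
  have hSb : ∀ n ω, |S n ω| ≤ n * B := fun n ω => by
    calc |S n ω| ≤ ∑ t ∈ Finset.range n, |Z t ω| := Finset.abs_sum_le_sum_abs _ _
      _ ≤ ∑ t ∈ Finset.range n, B := Finset.sum_le_sum fun i _ => hB i ω
      _ = n * B := by simp
  have hint : ∀ {f : Ω → ℝ} (_ : Measurable f) {c : ℝ} (_ : ∀ ω, |f ω| ≤ c), Integrable f μ :=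
    fun hf c hc => Integrable.of_bound hf.aestronglyMeasurable c (ae_of_all _ hc)
  have hprod : ∀ {f g : Ω → ℝ} (_ : Measurable f) (_ : Measurable g) {c d : ℝ}
      (_ : ∀ ω, |f ω| ≤ c) (_ : ∀ ω, |g ω| ≤ d), Integrable (fun ω => f ω * g ω) μ := by
    intro f g hf hg c d hc hd
    refine hint (c := c * d) (hf.mul hg) fun ω => ?_
    rw [abs_mul]
    exact mul_le_mul (hc ω) (hd ω) (abs_nonneg _) ((abs_nonneg _).trans (hc ω))
  -- Adding `Z n` to the sum raises the second moment by at most `C` (diagonal) plus `2 C ∑_{m ≥ 1}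
  -- α ^ m` (cross terms), hence by at most `D`.
  set D : ℝ := 2 * C / (1 - α) with hD
  have h1α : 0 < 1 - α := by linarith
  have hD0 : 0 ≤ D := by positivity
  have hcross : ∀ n, ∫ ω, S n ω * Z n ω ∂μ ≤ C * (∑ m ∈ Finset.range n, α ^ (m + 1)) := by
    intro n
    have h1 : ∫ ω, S n ω * Z n ω ∂μ = ∑ t ∈ Finset.range n, ∫ ω, Z t ω * Z n ω ∂μ := by
      rw [← integral_finsetSum _ fun i _ => hprod (hm i) (hm n) (hB i) (hB n)]
      simp [hS, Finset.sum_mul]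
    -- Reflection indexes the sum by the lag: the term `m` pairs time `n - 1 - m` with time `n`, at
    -- lag `m + 1`.
    rw [h1, ← Finset.sum_range_reflect, Finset.mul_sum]
    refine Finset.sum_le_sum fun m hmn => ?_
    have hmn := Finset.mem_range.1 hmn
    have h2 := hcov (n - 1 - m) (m + 1)
    rw [show n - 1 - m + (m + 1) = n by omega] at h2
    exact (le_abs_self _).trans h2
  have hsecond : ∀ n : ℕ, ∫ ω, S n ω ^ 2 ∂μ ≤ D * n := by
    intro n
    induction n with
    | zero => simp [hS]
    | succ n ih =>
      have h1 : ∀ ω, S (n + 1) ω ^ 2 = S n ω ^ 2 + (2 * (S n ω * Z n ω) + Z n ω * Z n ω) := by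
        intro ω
        simp only [hS, Finset.sum_range_succ]
        ring
      have i1 : Integrable (fun ω => S n ω ^ 2) μ := by
        simpa only [pow_two] using hprod (hSm n) (hSm n) (hSb n) (hSb n)
      have i2 := hprod (hSm n) (hm n) (hSb n) (hB n)
      have i3 := hprod (hm n) (hm n) (hB n) (hB n)
      have i4 : Integrable (fun ω => 2 * (S n ω * Z n ω) + Z n ω * Z n ω) μ :=
        (i2.const_mul 2).add i3
      simp_rw [h1]
      rw [integral_add i1 i4, integral_add (i2.const_mul 2) i3,
        integral_const_mul]
      have h2 := hcross n
      have h3 := (le_abs_self _).trans (hcov n 0)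
      simp only [add_zero, pow_zero, mul_one] at h3
      have h4 : ∑ m ∈ Finset.range n, α ^ (m + 1) = (∑ m ∈ Finset.range (n + 1), α ^ m) - 1 := by
        rw [Finset.sum_range_succ']
        simp
      have h5 : ∑ m ∈ Finset.range (n + 1), α ^ m ≤ 1 / (1 - α) := by
        have := (summable_geometric_of_lt_one hα0 hα1).sum_le_tsum (Finset.range (n + 1))
          fun i _ => pow_nonneg hα0 i
        rwa [tsum_geometric_of_lt_one hα0 hα1, ← one_div] at this
      have h6 : C * (∑ m ∈ Finset.range n, α ^ (m + 1)) ≤ C * (1 / (1 - α) - 1) := by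
        rw [h4]; gcongr
      have h7 : D = 2 * (C * (1 / (1 - α))) := by rw [hD]; ring
      push_cast
      nlinarith
  -- Along the squares the second moments of the averages are at most `D / (k + 1) ^ 2`, hence
  -- summable.
  have hsum : ∀ᵐ ω ∂μ, Summable fun k : ℕ => (S ((k + 1) ^ 2) ω / ((k : ℝ) + 1) ^ 2) ^ 2 := by
    have hi : ∀ k : ℕ, Integrable (fun ω => (S ((k + 1) ^ 2) ω / ((k : ℝ) + 1) ^ 2) ^ 2) μ := by
      intro k
      simp_rw [div_pow]
      refine Integrable.div_const ?_ _
      simpa only [pow_two (S _ _)] using hprod (hSm _) (hSm _) (hSb _) (hSb _)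
    have hle : ∑' k : ℕ, ∫⁻ ω, ENNReal.ofReal ((S ((k + 1) ^ 2) ω / ((k : ℝ) + 1) ^ 2) ^ 2) ∂μ
        ≤ ∑' k : ℕ, ENNReal.ofReal (D * (1 / ((k + 1 : ℕ) : ℝ) ^ 2)) := by
      refine ENNReal.tsum_le_tsum fun k => ?_
      rw [← ofReal_integral_eq_lintegral_ofReal (hi k) (ae_of_all _ fun ω => sq_nonneg _)]
      refine ENNReal.ofReal_le_ofReal ?_
      simp_rw [div_pow]
      rw [integral_div, div_le_iff₀ (by positivity)]
      refine (hsecond _).trans (le_of_eq ?_)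
      push_cast
      field_simp
    have hfin : ∑' k : ℕ, ENNReal.ofReal (D * (1 / ((k + 1 : ℕ) : ℝ) ^ 2)) ≠ ∞ := by
      refine Summable.tsum_ofReal_ne_top (Summable.mul_left D ?_)
      exact (summable_nat_add_iff 1).2 (Real.summable_one_div_nat_pow.2 one_lt_two)
    rw [← lintegral_tsum fun k => (hi k).aestronglyMeasurable.aemeasurable.ennreal_ofReal] at hle
    have := ae_lt_top' (AEMeasurable.tsum fun k =>
      (hi k).aestronglyMeasurable.aemeasurable.ennreal_ofReal) (ne_top_of_le_ne_top hfin hle)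
    filter_upwards [this] with ω hω
    have h1 := ENNReal.summable_toReal hω.ne
    refine h1.congr fun k => ?_
    rw [ENNReal.toReal_ofReal (sq_nonneg _)]
  filter_upwards [hsum] with ω hω
  have hk : Tendsto (fun k : ℕ => S ((k + 1) ^ 2) ω / ((k : ℝ) + 1) ^ 2) atTop (𝓝 0) := by
    have h := hω.tendsto_atTop_zero
    have h' := (Real.continuous_sqrt.tendsto 0).comp h
    simp only [Real.sqrt_zero] at h'
    refine (tendsto_zero_iff_abs_tendsto_zero _).2 (h'.congr fun k => ?_)
    simp [Real.sqrt_sq_eq_abs]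
  -- Adding `B` to each term makes the partial sums monotone. A limit along the squares then extends
  -- to all `n`, because consecutive squares have ratio tending to 1.
  have hmain : Tendsto (fun n : ℕ => (S n ω + n * B) / n) atTop (𝓝 B) := by
    refine tendsto_div_of_monotone_of_exists_subseq_tendsto_div _ _ ?_ ?_
    · refine monotone_nat_of_le_succ fun n => ?_
      simp only [hS, Finset.sum_range_succ]
      push_cast
      have := neg_le_of_abs_le (hB n ω)
      linarith
    · intro a ha
      refine ⟨fun k => (k + 1) ^ 2, ?_, ?_, ?_⟩
      · have h1 : Tendsto (fun k : ℕ => (1 + 1 / ((k : ℝ) + 1)) ^ 2) atTop (𝓝 1) := by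
          simpa using ((tendsto_one_div_add_atTop_nhds_zero_nat (𝕜 := ℝ)).const_add 1).pow 2
        filter_upwards [h1.eventually (gt_mem_nhds ha)] with k hk
        push_cast
        have : ((k : ℝ) + 1 + 1) ^ 2 = (1 + 1 / ((k : ℝ) + 1)) ^ 2 * ((k : ℝ) + 1) ^ 2 := by
          field_simp
        rw [this]
        gcongr
      · exact (tendsto_pow_atTop two_ne_zero).comp (tendsto_add_atTop_nat 1)
      · have := hk.add_const B
        rw [zero_add] at this
        refine this.congr fun k => ?_
        push_cast
        field_simp
  have := hmain.sub_const B
  rw [sub_self] at this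
  refine this.congr' ?_
  filter_upwards [eventually_gt_atTop 0] with n hn
  have : (n : ℝ) ≠ 0 := by positivity
  field_simp
  ring

/-- On a separable metric space, weak convergence can be tested on countably many bounded Lipschitz
functions. -/
theorem exists_countable_lipschitz_convergence_determining (E : Type*) [MetricSpace E]
    [MeasurableSpace E] [BorelSpace E] [SecondCountableTopology E] :
    ∃ 𝓕 : Set (E → ℝ), 𝓕.Countable ∧
      (∀ f ∈ 𝓕, (∃ B, ∀ x, |f x| ≤ B) ∧ ∃ L, LipschitzWith L f) ∧
      ∀ (π : ProbabilityMeasure E) (μ : ℕ → ProbabilityMeasure E),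
        (∀ f ∈ 𝓕, Tendsto (fun n => ∫ x, f x ∂(μ n : Measure E)) atTop
          (𝓝 (∫ x, f x ∂(π : Measure E)))) → Tendsto μ atTop (𝓝 π) := by
  set S := TopologicalSpace.countableBasis E with hS
  have hSc : S.Countable := TopologicalSpace.countable_countableBasis E
  have hSb := TopologicalSpace.isBasis_countableBasis E
  -- For open `U` with nonempty complement these Lipschitz functions increase to the indicator of
  -- `U` as `k` grows.
  let g : Set E → ℕ → E → ℝ := fun U k x => min 1 (k * Metric.infDist x Uᶜ)
  have hg0 : ∀ U k x, 0 ≤ g U k x := fun U k x =>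
    le_min zero_le_one (mul_nonneg k.cast_nonneg Metric.infDist_nonneg)
  have hg1 : ∀ U k x, g U k x ≤ 1 := fun U k x => min_le_left _ _
  have hgL : ∀ U (k : ℕ), LipschitzWith (k : ℝ≥0) (g U k) := fun U k => by
    refine LipschitzWith.const_min ?_ 1
    refine LipschitzWith.of_dist_le_mul fun x y => ?_
    rw [Real.dist_eq, ← mul_sub, abs_mul, abs_of_nonneg (Nat.cast_nonneg k), ← Real.dist_eq]
    simpa using mul_le_mul_of_nonneg_left
      ((Metric.lipschitz_infDist_pt Uᶜ).dist_le_mul x y) (Nat.cast_nonneg (α := ℝ) k)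
  have hgm : ∀ U k, Measurable (g U k) := fun U k => (hgL U k).continuous.measurable
  have hgi : ∀ U k (ν : ProbabilityMeasure E), Integrable (g U k) (ν : Measure E) := fun U k ν =>
    Integrable.of_bound (hgm U k).aestronglyMeasurable 1
      (ae_of_all _ fun x => by rw [Real.norm_of_nonneg (hg0 U k x)]; exact hg1 U k x)
  have hg_out : ∀ U k x, x ∉ U → g U k x = 0 := fun U k x hx => by
    simp [g, Metric.infDist_zero_of_mem (show x ∈ Uᶜ from hx)]
  refine ⟨⋃ T ∈ {T : Set (Set E) | T.Finite ∧ T ⊆ S}, Set.range (g (⋃ t ∈ T, t)), ?_, ?_, ?_⟩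
  · exact (Set.countable_ofPred_finite_subset hSc).biUnion fun T _ => Set.countable_range _
  · intro f hf
    simp only [Set.mem_iUnion, Set.mem_range] at hf
    obtain ⟨T, -, k, rfl⟩ := hf
    exact ⟨⟨1, fun x => abs_le.2 ⟨by linarith [hg0 (⋃ t ∈ T, t) k x], hg1 _ k x⟩⟩, _, hgL _ k⟩
  · intro π μ h
    refine tendsto_of_forall_isOpen_le_liminf_nat fun G hG => ?_
    -- The whole space is separate: the distance to an empty complement is 0 by convention, so `g`
    -- would vanish there.
    by_cases hGu : G = Set.univ
    · simp [hGu]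
    refine le_of_forall_lt fun c hc => ?_
    -- Finite unions of basic sets approximate `G` from inside in `π`-measure, which keeps the test
    -- family countable.
    obtain ⟨T, hTS, hcT, hTG⟩ := π.exists_lt_measure_biUnion_of_isOpen (S := S)
      (fun u hu x hx => by
        obtain ⟨v, hv, hxv, hvu⟩ := hSb.exists_subset_of_mem_open hx hu
        exact ⟨v, hv, (hSb.isOpen hv).mem_nhds hxv, hvu⟩) hG hc
    set U := ⋃ t ∈ T, t with hU
    have hUo : IsOpen U := isOpen_biUnion fun t ht => hSb.isOpen (hTS t ht)
    have hUne : (Uᶜ).Nonempty := by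
      rw [Set.nonempty_compl]
      intro h0
      exact hGu (Set.eq_univ_of_univ_subset (h0 ▸ hTG))
    have hlim : Tendsto (fun k => ∫ x, g U k x ∂(π : Measure E)) atTop
        (𝓝 (∫ x, U.indicator 1 x ∂(π : Measure E))) := by
      refine tendsto_integral_of_dominated_convergence (fun _ => 1)
        (fun k => (hgm U k).aestronglyMeasurable) (integrable_const _)
        (fun k => ae_of_all _ fun x => by
          rw [Real.norm_of_nonneg (hg0 U k x)]; exact hg1 U k x) (ae_of_all _ fun x => ?_)
      by_cases hx : x ∈ U
      · rw [Set.indicator_of_mem hx]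
        have hpos : 0 < Metric.infDist x Uᶜ :=
          (hUo.isClosed_compl.notMem_iff_infDist_pos hUne).1 (by simpa using hx)
        refine tendsto_const_nhds.congr' ?_
        filter_upwards [(tendsto_natCast_atTop_atTop.atTop_mul_const hpos).eventually_ge_atTop 1]
          with k hk
        exact (min_eq_left hk).symm
      · rw [Set.indicator_of_notMem hx]
        exact tendsto_const_nhds.congr fun k => (hg_out U k x hx).symm
    rw [integral_indicator_one hUo.measurableSet] at hlim
    obtain ⟨d, hcd, hdU⟩ := exists_between hcT
    have hdU' : (d : ℝ) < (π : Measure E).real U := by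
      have : (d : ℝ) < (π U : ℝ) := by exact_mod_cast hdU
      simpa using this
    obtain ⟨k, hk⟩ := (hlim.eventually (lt_mem_nhds hdU')).exists
    have hμ := h (g U k) (by
      simp only [Set.mem_iUnion, Set.mem_range]
      exact ⟨(T : Set (Set E)), ⟨T.finite_toSet, fun t ht => hTS t ht⟩, k, by simp [hU]⟩)
    refine lt_of_lt_of_le hcd (le_liminf_of_le ?_ ?_)
    · exact IsBoundedUnder.isCoboundedUnder_ge ⟨1, by simp⟩
    · filter_upwards [hμ.eventually (lt_mem_nhds hk)] with n hn
      have h1 : ∫ x, g U k x ∂(μ n : Measure E) ≤ ((μ n : Measure E)).real G := by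
        rw [← integral_indicator_one hG.measurableSet]
        refine integral_mono (hgi U k _)
          ((integrable_const (1 : ℝ)).indicator hG.measurableSet) fun x => ?_
        by_cases hx : x ∈ U
        · rw [Set.indicator_of_mem (hTG hx)]; exact hg1 U k x
        · rw [hg_out U k x hx]; exact Set.indicator_nonneg (fun _ _ => zero_le_one) x
      have h2 : (d : ℝ) ≤ (μ n G : ℝ) := by simpa using hn.le.trans h1
      exact_mod_cast h2

/-! ### Transition averages and the Markov property -/

section KernelMean

variable {E : Type*} [MeasurableSpace E]

/-- The action of a kernel on real functions. -/
noncomputable def kernelMean (κ : Kernel E E) (f : E → ℝ) (x : E) : ℝ := ∫ y, f y ∂κ x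

theorem measurable_kernelMean (κ : Kernel E E) [IsMarkovKernel κ] {f : E → ℝ} (hf : Measurable f) :
    Measurable (kernelMean κ f) :=
  (StronglyMeasurable.integral_kernel hf.stronglyMeasurable).measurable

theorem abs_kernelMean_le (κ : Kernel E E) [IsMarkovKernel κ] {f : E → ℝ} {B : ℝ}
    (hB : ∀ x, |f x| ≤ B) (x : E) : |kernelMean κ f x| ≤ B := by
  have := norm_integral_le_of_norm_le_const (μ := κ x) (C := B)
    (ae_of_all _ fun y => (Real.norm_eq_abs (f y)).le.trans (hB y))
  simpa [kernelMean] using this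

theorem measurable_iterate_kernelMean (κ : Kernel E E) [IsMarkovKernel κ] {f : E → ℝ}
    (hf : Measurable f) (m : ℕ) : Measurable ((kernelMean κ)^[m] f) := by
  induction m with
  | zero => exact hf
  | succ m ih =>
    rw [Function.iterate_succ_apply']
    exact measurable_kernelMean κ ih

theorem abs_iterate_kernelMean_le (κ : Kernel E E) [IsMarkovKernel κ] {f : E → ℝ} {B : ℝ}
    (hB : ∀ x, |f x| ≤ B) (m : ℕ) (x : E) : |(kernelMean κ)^[m] f x| ≤ B := by
  induction m generalizing x with
  | zero => exact hB x
  | succ m ih =>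
    rw [Function.iterate_succ_apply']
    exact abs_kernelMean_le κ ih x

theorem integrable_of_abs_le {μ : Measure E} [IsFiniteMeasure μ] {f : E → ℝ} (hf : Measurable f)
    {B : ℝ} (hB : ∀ x, |f x| ≤ B) : Integrable f μ :=
  Integrable.of_bound hf.aestronglyMeasurable B (ae_of_all _ hB)

theorem integral_bind_eq_integral_kernelMean (κ : Kernel E E) [IsMarkovKernel κ] (μ : Measure E)
    [IsFiniteMeasure μ] {f : E → ℝ} (hf : Measurable f) {B : ℝ} (hB : ∀ x, |f x| ≤ B) :
    ∫ x, f x ∂(μ.bind κ) = ∫ x, kernelMean κ f x ∂μ := by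
  have h : (κ ∘ₖ Kernel.const Unit μ) () = μ.bind κ := by
    rw [Kernel.comp_apply, Kernel.const_apply]
  rw [← h, Kernel.integral_comp (by rw [h]; exact integrable_of_abs_le hf hB)]
  simp [kernelMean]

end KernelMean

namespace IsMarkovChain

variable {E : Type*} [MeasurableSpace E] {Ω : Type*}

/-- The `σ`-algebra generated by the first `n + 1` values of a sequence. -/
abbrev past (X : ℕ → Ω → E) (n : ℕ) : MeasurableSpace Ω :=
  ⨆ i : Fin (n + 1), MeasurableSpace.comap (X i) inferInstance

theorem past_mono (X : ℕ → Ω → E) {m n : ℕ} (hmn : m ≤ n) : past X m ≤ past X n :=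
  iSup_le fun i => le_iSup (fun j : Fin (n + 1) => MeasurableSpace.comap (X j) inferInstance)
    ⟨i, by omega⟩

theorem measurable_past (X : ℕ → Ω → E) {m n : ℕ} (hmn : m ≤ n) : Measurable[past X n] (X m) :=
  Measurable.of_comap_le
    (le_iSup (fun j : Fin (n + 1) => MeasurableSpace.comap (X j) inferInstance) ⟨m, by omega⟩)

variable [MeasurableSpace Ω] {κ : Kernel E E} {ν : Measure E} {P : Measure Ω} {X : ℕ → Ω → E}

theorem past_le (h : IsMarkovChain κ ν P X) (n : ℕ) : past X n ≤ ‹MeasurableSpace Ω› :=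
  iSup_le fun i => (h.measurable i).comap_le

/-- Integrating the transition identity over a past event turns it into an identity of finite
measures. In this form it also applies to unbounded nonnegative functions such as a Lyapunov
function. -/
theorem map_restrict_succ [IsMarkovKernel κ] [IsProbabilityMeasure P]
    (h : IsMarkovChain κ ν P X) {n : ℕ} {s : Set Ω} (hs : MeasurableSet[past X n] s) :
    (P.restrict s).map (X (n + 1)) = ((P.restrict s).map (X n)).bind κ := by
  have hs' := h.past_le n s hs
  ext A hA
  rw [Measure.map_apply (h.measurable _) hA, Measure.bind_apply hA κ.aemeasurable,
    lintegral_map (κ.measurable_coe hA) (h.measurable n),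
    Measure.restrict_apply (h.measurable _ hA)]
  have hB := h.measurable (n + 1) hA
  have h1 : ∫ ω in s, (X (n + 1) ⁻¹' A).indicator (fun _ => (1 : ℝ)) ω ∂P
      = ∫ ω in s, (κ (X n ω)).real A ∂P := by
    rw [← setIntegral_condExp (h.past_le n) ((integrable_const 1).indicator hB) hs]
    exact integral_congr_ae (ae_restrict_of_ae (h.transition n A hA))
  rw [integral_indicator_const _ hB, smul_eq_mul, mul_one, measureReal_restrict_apply hB] at h1
  have hm : Measurable fun ω => (κ (X n ω)).real A :=
    ((κ.measurable_coe hA).comp (h.measurable n)).ennreal_toReal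
  have hi : Integrable (fun ω => (κ (X n ω)).real A) (P.restrict s) :=
    Integrable.of_bound hm.aestronglyMeasurable 1 (ae_of_all _ fun ω => by
      rw [Real.norm_of_nonneg measureReal_nonneg]; exact measureReal_le_one)
  have h2 := ofReal_integral_eq_lintegral_ofReal hi (ae_of_all _ fun ω => measureReal_nonneg)
  rw [← h1, ofReal_measureReal] at h2
  rw [h2]
  exact lintegral_congr fun ω => ofReal_measureReal

theorem condExp_comp_succ [IsMarkovKernel κ] [IsProbabilityMeasure P]
    (h : IsMarkovChain κ ν P X) (n : ℕ) {f : E → ℝ} (hf : Measurable f) {B : ℝ}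
    (hB : ∀ x, |f x| ≤ B) :
    P[fun ω => f (X (n + 1) ω) | past X n] =ᵐ[P] fun ω => kernelMean κ f (X n ω) := by
  have hk := measurable_kernelMean κ hf
  refine (ae_eq_condExp_of_forall_setIntegral_eq (h.past_le n)
    (integrable_of_abs_le (hf.comp (h.measurable _)) fun ω => hB _)
    (fun s _ _ => (integrable_of_abs_le (hk.comp (h.measurable n))
      fun ω => abs_kernelMean_le κ hB _).integrableOn) (fun s hs _ => ?_) ?_).symm
  · simp only [Function.comp_apply]
    rw [← integral_map (h.measurable n).aemeasurable hk.aestronglyMeasurable,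
      ← integral_map (h.measurable (n + 1)).aemeasurable hf.aestronglyMeasurable,
      h.map_restrict_succ hs, integral_bind_eq_integral_kernelMean κ _ hf hB]
  · exact (hk.comp (measurable_past X le_rfl)).stronglyMeasurable.aestronglyMeasurable

/-- Conditioning on the past up to time `n + m` replaces `f` by its transition average and removes
the last step; `ψ` is known at that time and factors out. -/
theorem integral_mul_add [IsMarkovKernel κ] [IsProbabilityMeasure P]
    (h : IsMarkovChain κ ν P X) (n m : ℕ) {f : E → ℝ} (hf : Measurable f) {B : ℝ}
    (hB : ∀ x, |f x| ≤ B) {ψ : Ω → ℝ} (hψ : Measurable[past X n] ψ) {B' : ℝ}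
    (hB' : ∀ ω, |ψ ω| ≤ B') :
    ∫ ω, ψ ω * f (X (n + m) ω) ∂P = ∫ ω, ψ ω * (kernelMean κ)^[m] f (X n ω) ∂P := by
  induction m generalizing f with
  | zero => rfl
  | succ m ih =>
    rw [Function.iterate_succ_apply, ← ih (measurable_kernelMean κ hf) (abs_kernelMean_le κ hB),
      ← add_assoc]
    have hψm : Measurable[past X (n + m)] ψ := hψ.mono (past_mono X (by omega)) le_rfl
    have hψ' := hψ.mono (h.past_le n) le_rfl
    have hi : Integrable (fun ω => f (X (n + m + 1) ω)) P :=
      integrable_of_abs_le (hf.comp (h.measurable _)) fun ω => hB _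
    have hi' : Integrable (ψ * fun ω => f (X (n + m + 1) ω)) P :=
      hi.bdd_mul hψ'.aestronglyMeasurable (ae_of_all _ hB')
    have h1 := condExp_mul_of_stronglyMeasurable_left hψm.stronglyMeasurable hi' hi
    have h2 := integral_condExp (h.past_le (n + m)) (f := ψ * fun ω => f (X (n + m + 1) ω)) (μ := P)
    simp only [Pi.mul_apply] at h2
    rw [← h2]
    refine integral_congr_ae (h1.trans ?_)
    filter_upwards [h.condExp_comp_succ (n + m) hf hB] with ω hω
    rw [Pi.mul_apply, hω]

end IsMarkovChain

/-! ### From geometric convergence of averages to stability -/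

theorem integral_empiricalDistribution {E : Type*} [MeasurableSpace E] (x : ℕ → E) (n : ℕ)
    {f : E → ℝ} (hf : Measurable f) :
    ∫ y, f y ∂(empiricalDistribution x n : Measure E)
      = (∑ t ∈ Finset.range (n + 1), f (x t)) / ((n + 1 : ℕ) : ℝ) := by
  have h : (empiricalDistribution x n : Measure E)
      = ((n : ℝ≥0∞) + 1)⁻¹ • ∑ t ∈ Finset.range (n + 1), Measure.dirac (x t) := rfl
  rw [h, integral_smul_measure, integral_finsetSum_measure]
  · simp only [integral_dirac' _ _ hf.stronglyMeasurable]
    rw [ENNReal.toReal_inv, smul_eq_mul, inv_mul_eq_div]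
    congr 1
    rw [show (n : ℝ≥0∞) + 1 = ((n + 1 : ℕ) : ℝ≥0∞) by push_cast; rfl, ENNReal.toReal_natCast]
  · intro i _
    exact integrable_dirac' hf.stronglyMeasurable enorm_lt_top

/-- A Markov chain with a Lyapunov function, along which the averages of bounded Lipschitz
functions converge geometrically, is stable. -/
theorem isStableChain_of_geometric.{w, v} {E : Type v} [MetricSpace E] [MeasurableSpace E]
    [BorelSpace E] [SecondCountableTopology E] (κ : Kernel E E) [IsMarkovKernel κ]
    (π : ProbabilityMeasure E) {W : E → ℝ} (hW : Measurable W) (hW0 : ∀ x, 0 ≤ W x) {C : ℝ≥0}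
    (hdrift : ∀ x, ∫⁻ y, ENNReal.ofReal (W y) ∂κ x ≤ ENNReal.ofReal (W x) / 2 + C)
    (hgeo : ∀ f : E → ℝ, (∃ B, ∀ x, |f x| ≤ B) → (∃ L, LipschitzWith L f) →
      ∃ D α : ℝ, 0 ≤ D ∧ 0 ≤ α ∧ α < 1 ∧ ∀ m x,
        |(kernelMean κ)^[m] f x - ∫ y, f y ∂(π : Measure E)| ≤ D * α ^ m * W x) :
    IsStableChain.{w, v} κ π := by
  intro ν _ Ω _ P _ X h
  have hW' : Measurable fun x => ENNReal.ofReal (W x) := hW.ennreal_ofReal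
  have hkey : ∀ f : E → ℝ, (∃ B, ∀ x, |f x| ≤ B) → (∃ L, LipschitzWith L f) →
      ∀ᵐ ω ∂P, Tendsto (fun n => ∫ x, f x ∂(empiricalDistribution (fun t => X t ω) n : Measure E))
        atTop (𝓝 (∫ x, f x ∂(π : Measure E))) := by
    rintro f ⟨B, hB⟩ hL
    have hfm : Measurable f := hL.choose_spec.continuous.measurable
    obtain ⟨D, α, hD, hα0, hα1, hDα⟩ := hgeo f ⟨B, hB⟩ hL
    set c := ∫ x, f x ∂(π : Measure E) with hc
    set Z : ℕ → Ω → ℝ := fun t ω => f (X t ω) - c with hZ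
    have hcB : |c| ≤ B := by
      have := norm_integral_le_of_norm_le_const (μ := (π : Measure E)) (C := B)
        (ae_of_all _ fun y => (Real.norm_eq_abs (f y)).le.trans (hB y))
      simpa using this
    have hgm : Measurable fun x => f x - c := hfm.sub_const c
    have hgB : ∀ x, |f x - c| ≤ 2 * B := fun x =>
      (abs_sub _ _).trans (by linarith [hB x])
    have hB0 : 0 ≤ B := (abs_nonneg c).trans hcB
    have hiter : ∀ m x, (kernelMean κ)^[m] (fun x => f x - c) x = (kernelMean κ)^[m] f x - c := by
      intro m
      induction m with
      | zero => intro x; rfl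
      | succ m ih =>
        intro x
        rw [Function.iterate_succ_apply', Function.iterate_succ_apply']
        have : (kernelMean κ)^[m] (fun x => f x - c) = fun x => (kernelMean κ)^[m] f x - c :=
          funext ih
        rw [this]
        simp only [kernelMean]
        rw [integral_sub (integrable_of_abs_le (measurable_iterate_kernelMean κ hfm m)
          (abs_iterate_kernelMean_le κ hB m)) (integrable_const _)]
        simp
    -- The initial law need not integrate `W`. On the past event `W (X 0) ≤ N` the moments of `W (X
    -- s)` are bounded uniformly in `s`, and these events exhaust `Ω`.
    have hN : ∀ N : ℕ, ∀ᵐ ω ∂(P.restrict {ω | W (X 0 ω) ≤ N}),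
        Tendsto (fun n : ℕ => (∑ t ∈ Finset.range n, Z t ω) / n) atTop (𝓝 0) := by
      intro N
      set A : Set Ω := {ω | W (X 0 ω) ≤ N} with hA
      have hApast : ∀ n, MeasurableSet[IsMarkovChain.past X n] A := fun n =>
        (hW.comp (IsMarkovChain.measurable_past X n.zero_le)) measurableSet_Iic
      have hAm : MeasurableSet A := h.past_le 0 _ (hApast 0)
      -- `2 C` is the fixed point of `m ↦ m / 2 + C`, so the bound `M` reproduces itself under the
      -- drift.
      set M : ℝ≥0∞ := N + 2 * C with hM
      have hmom : ∀ s, ∫⁻ ω in A, ENNReal.ofReal (W (X s ω)) ∂P ≤ M := by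
        intro s
        induction s with
        | zero =>
          calc ∫⁻ ω in A, ENNReal.ofReal (W (X 0 ω)) ∂P ≤ ∫⁻ ω in A, (N : ℝ≥0∞) ∂P := by
                refine setLIntegral_mono measurable_const fun ω hω => ?_
                exact ENNReal.ofReal_le_of_le_toReal (by simpa [hA] using hω)
            _ = N * P A := by simp
            _ ≤ N * 1 := by gcongr; exact prob_le_one
            _ ≤ M := by rw [mul_one]; exact le_self_add
        | succ s ih =>
          rw [← lintegral_map hW' (h.measurable (s + 1)), h.map_restrict_succ (hApast s),
            Measure.lintegral_bind κ.aemeasurable hW'.aemeasurable]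
          calc ∫⁻ x, ∫⁻ y, ENNReal.ofReal (W y) ∂κ x ∂((P.restrict A).map (X s))
              ≤ ∫⁻ x, (ENNReal.ofReal (W x) / 2 + C) ∂((P.restrict A).map (X s)) :=
                lintegral_mono hdrift
            _ = ∫⁻ ω in A, (ENNReal.ofReal (W (X s ω)) / 2 + C) ∂P :=
                lintegral_map (by fun_prop) (h.measurable s)
            _ = (∫⁻ ω in A, ENNReal.ofReal (W (X s ω)) ∂P) / 2 + C * P A := by
                have hWs : Measurable fun ω => ENNReal.ofReal (W (X s ω)) :=
                  hW'.comp (h.measurable s)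
                simp_rw [div_eq_mul_inv]
                rw [lintegral_add_right _ measurable_const, lintegral_mul_const _ hWs]
                simp
            _ ≤ M / 2 + C * 1 := by gcongr; exact prob_le_one
            _ ≤ M := by
                rw [hM, mul_one, ENNReal.add_div, mul_comm 2, ENNReal.mul_div_cancel_right
                  two_ne_zero ENNReal.ofNat_ne_top, add_assoc, mul_two]
                gcongr
                exact ENNReal.half_le_self
      have hMtop : M ≠ ∞ := by
        rw [hM]
        exact ENNReal.add_ne_top.2 ⟨ENNReal.natCast_ne_top N,
          ENNReal.mul_ne_top ENNReal.ofNat_ne_top ENNReal.coe_ne_top⟩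
      have hWi : ∀ s, Integrable (fun ω => W (X s ω)) (P.restrict A) := fun s =>
        ⟨(hW.comp (h.measurable s)).aestronglyMeasurable, by
          rw [hasFiniteIntegral_iff_ofReal (ae_of_all _ fun ω => hW0 _)]
          exact (hmom s).trans_lt hMtop.lt_top⟩
      have hWint : ∀ s, ∫ ω in A, W (X s ω) ∂P ≤ M.toReal := fun s => by
        rw [integral_eq_lintegral_of_nonneg_ae (ae_of_all _ fun ω => hW0 _)
          (hW.comp (h.measurable s)).aestronglyMeasurable]
        exact ENNReal.toReal_mono hMtop (hmom s)
      refine ae_tendsto_average_zero_of_correlation (P.restrict A) (B := 2 * B)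
        (C := 2 * B * D * M.toReal) (α := α) (fun n => hgm.comp (h.measurable n))
        (fun n ω => hgB _) (by positivity) hα0 hα1 fun s m => ?_
      have hψ : Measurable[IsMarkovChain.past X s] (A.indicator (Z s)) :=
        (hgm.comp (IsMarkovChain.measurable_past X le_rfl)).indicator (hApast s)
      have hψB : ∀ ω, |A.indicator (Z s) ω| ≤ 2 * B := fun ω => by
        by_cases hω : ω ∈ A
        · rw [Set.indicator_of_mem hω]; exact hgB _
        · rw [Set.indicator_of_notMem hω, abs_zero]; positivity
      have hswap : ∀ k : Ω → ℝ, ∫ ω in A, Z s ω * k ω ∂P = ∫ ω, A.indicator (Z s) ω * k ω ∂P := by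
        intro k
        rw [← integral_indicator hAm]
        refine integral_congr_ae (ae_of_all _ fun ω => ?_)
        by_cases hω : ω ∈ A <;> simp [hω]
      -- With `A` absorbed into the past factor, the Markov property turns the correlation into the
      -- deviation of an `m`-step average, which is at most `D * α ^ m * W`.
      rw [hswap, h.integral_mul_add s m hgm hgB hψ hψB, ← hswap]
      refine (abs_integral_le_integral_abs).trans ?_
      calc ∫ ω in A, |Z s ω * (kernelMean κ)^[m] (fun x => f x - c) (X s ω)| ∂P
          ≤ ∫ ω in A, 2 * B * D * α ^ m * W (X s ω) ∂P := by
            refine integral_mono_of_nonneg (ae_of_all _ fun ω => abs_nonneg _)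
              ((hWi s).const_mul _) (ae_of_all _ fun ω => ?_)
            simp only
            rw [abs_mul, hiter]
            calc |Z s ω| * |(kernelMean κ)^[m] f (X s ω) - c| ≤ 2 * B * (D * α ^ m * W (X s ω)) :=
                  mul_le_mul (hgB _) (hDα m _) (abs_nonneg _) (by positivity)
              _ = _ := by ring
        _ = 2 * B * D * α ^ m * ∫ ω in A, W (X s ω) ∂P := integral_const_mul _ _
        _ ≤ 2 * B * D * α ^ m * M.toReal := by gcongr; exact hWint s
        _ = _ := by ring
    have hall : ∀ᵐ ω ∂P, Tendsto (fun n : ℕ => (∑ t ∈ Finset.range n, Z t ω) / n) atTop (𝓝 0) := by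
      have h1 : ∀ᵐ ω ∂P, ∀ N : ℕ, W (X 0 ω) ≤ N →
          Tendsto (fun n : ℕ => (∑ t ∈ Finset.range n, Z t ω) / n) atTop (𝓝 0) := by
        refine ae_all_iff.2 fun N => ?_
        exact (ae_restrict_iff' ((hW.comp (h.measurable 0)) measurableSet_Iic)).1 (hN N)
      filter_upwards [h1] with ω hω
      obtain ⟨N, hN'⟩ := exists_nat_ge (W (X 0 ω))
      exact hω N hN'
    filter_upwards [hall] with ω hω
    have h2 := ((tendsto_add_atTop_iff_nat 1).2 hω).add_const c
    rw [zero_add] at h2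
    refine h2.congr fun n => ?_
    rw [integral_empiricalDistribution _ _ hfm]
    simp only [hZ, Finset.sum_sub_distrib, Finset.sum_const, Finset.card_range, nsmul_eq_mul]
    have : ((n + 1 : ℕ) : ℝ) ≠ 0 := by positivity
    field_simp
    ring
  obtain ⟨𝓕, hcount, hbdd, hdet⟩ := exists_countable_lipschitz_convergence_determining E
  have := (ae_ball_iff hcount).2 fun f hf => hkey f (hbdd f hf).1 (hbdd f hf).2
  filter_upwards [this] with ω hω
  exact hdet π _ hω

/-! ### Elementary inequalities behind the contraction -/

section RealInequalities

/-- By convexity of the exponential, `exp (-κ t) - exp (-t)` is at least `exp (-κ t) (1 - κ) (1 -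
exp (-t))`, and `exp (-κ t) ≥ exp (-T)`. The gain is uniform only for bounded `t`. -/
theorem one_sub_exp_neg_mul_le {κ t T : ℝ} (hκ0 : 0 ≤ κ) (hκ1 : κ ≤ 1) (ht : 0 ≤ t) (htT : t ≤ T) :
    1 - Real.exp (-(κ * t)) ≤ (1 - Real.exp (-T) * (1 - κ)) * (1 - Real.exp (-t)) := by
  have hconv : Real.exp (-((1 - κ) * t)) ≤ κ + (1 - κ) * Real.exp (-t) := by
    have := convexOn_exp.2 (Set.mem_univ (0 : ℝ)) (Set.mem_univ (-t)) hκ0 (sub_nonneg.2 hκ1)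
      (by ring)
    simpa using this
  have hsplit : Real.exp (-t) = Real.exp (-(κ * t)) * Real.exp (-((1 - κ) * t)) := by
    rw [← Real.exp_add]; congr 1; ring
  have hge : Real.exp (-T) ≤ Real.exp (-(κ * t)) := Real.exp_le_exp.2 (by nlinarith)
  have he : 0 ≤ 1 - Real.exp (-t) := by
    have := Real.exp_le_one_iff.2 (neg_nonpos.2 ht); linarith
  have h1 : Real.exp (-(κ * t)) * ((1 - κ) * (1 - Real.exp (-t)))
      ≤ Real.exp (-(κ * t)) - Real.exp (-t) := by
    have : Real.exp (-(κ * t)) - Real.exp (-t)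
        = Real.exp (-(κ * t)) * (1 - Real.exp (-((1 - κ) * t))) := by
      rw [mul_sub, ← hsplit, mul_one]
    rw [this]
    gcongr
    linarith
  have h2 : Real.exp (-T) * ((1 - κ) * (1 - Real.exp (-t)))
      ≤ Real.exp (-(κ * t)) * ((1 - κ) * (1 - Real.exp (-t))) :=
    mul_le_mul_of_nonneg_right hge (mul_nonneg (sub_nonneg.2 hκ1) he)
  nlinarith

theorem min_one_le_two_mul_one_sub_exp_neg {w : ℝ} (hw : 0 ≤ w) :
    min 1 w ≤ 2 * (1 - Real.exp (-w)) := by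
  have h1 : Real.exp (-1) ≤ 1 / 2 := by
    have := Real.exp_one_gt_d9
    rw [Real.exp_neg, inv_le_comm₀ (Real.exp_pos 1) (by norm_num)]
    norm_num
    linarith
  rcases le_total 1 w with h | h
  · rw [min_eq_left h]
    have : Real.exp (-w) ≤ Real.exp (-1) := Real.exp_le_exp.2 (by linarith)
    linarith
  · rw [min_eq_right h]
    have hconv := convexOn_exp.2 (Set.mem_univ (0 : ℝ)) (Set.mem_univ (-1 : ℝ))
      (sub_nonneg.2 h) hw (by ring)
    simp only [smul_eq_mul, mul_zero, zero_add, mul_neg, mul_one, Real.exp_zero] at hconv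
    nlinarith

/-- Choice of the weight that makes the weighted distance contract. -/
theorem exists_contracting_weight {ε a C : ℝ} (hε : 0 < ε) (ha0 : 0 ≤ a) (ha1 : a < 1)
    (hC : 0 ≤ C) :
    ∃ β α : ℝ, 0 < β ∧ 0 ≤ α ∧ α < 1 ∧ ∀ w s : ℝ, 0 ≤ w → ε * w ≤ s →
      (1 - Real.exp (-((1 + 2 / (1 - a) * a) * w))) * (1 + β * (s / 2 + 2 * C))
        ≤ α ^ 2 * ((1 - Real.exp (-(2 / (1 - a) * w))) * (1 + β * s)) := by
  have h1a : 0 < 1 - a := by linarith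
  -- This `K` gives `1 + K a = κ K` with `κ = (1 + a) / 2 < 1`.
  set K := 2 / (1 - a) with hK
  have hK0 : 0 < K := by positivity
  set κ := (1 + a) / 2 with hκ
  have hKκ : 1 + K * a = κ * K := by rw [hK, hκ]; field_simp; ring
  -- `R` separates two cases. For `s ≥ R` one has `2 C ≤ s / 4`, so the drift shrinks `s` to at most
  -- `3 s / 4`. For `s < R` the hypothesis `ε w ≤ s` bounds `K w` by `T`, and the bounded factor
  -- contracts by `1 - δ`.
  set R := 8 * C + 8 with hR
  have hR0 : 0 < R := by positivity
  set T := K * (R / ε) with hT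
  have hT0 : 0 < T := by positivity
  set δ := Real.exp (-T) * (1 - κ) with hδ
  have hκ1 : κ < 1 := by rw [hκ]; linarith
  have hκ0 : 0 ≤ κ := by rw [hκ]; linarith
  have hδ0 : 0 < δ := mul_pos (Real.exp_pos _) (by linarith)
  have hδ1 : δ ≤ 1 := by
    have : Real.exp (-T) ≤ 1 := Real.exp_le_one_iff.2 (by linarith)
    have := Real.exp_pos (-T)
    rw [hδ]; nlinarith
  -- With `2 C β ≤ δ`, the weight grows at most by `1 + δ` when `s < R`, leaving the factor `(1 - δ)
  -- (1 + δ) = 1 - δ ^ 2`.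
  set β := δ / (2 * C + 1) with hβ
  have hβ0 : 0 < β := by positivity
  have hβC : 2 * C * β ≤ δ := by
    rw [hβ, mul_div_assoc', div_le_iff₀ (by positivity)]; nlinarith
  -- For `s ≥ R` the gain `β s / 4`, relative to `1 + β s`, is smallest at `s = R`.
  set γ := 1 - (β * R / 4) / (1 + β * R) with hγ
  have hγ1 : γ < 1 := by
    rw [hγ]
    have : 0 < (β * R / 4) / (1 + β * R) := by positivity
    linarith
  set q := max (1 - δ ^ 2) γ with hq
  have hq1 : q < 1 := max_lt (by nlinarith) hγ1
  have hq0 : 0 ≤ q := le_max_of_le_left (by nlinarith)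
  -- The distance will be a product of square roots, so its rate is the square root of `q`.
  refine ⟨β, Real.sqrt q, hβ0, Real.sqrt_nonneg _, ?_, fun w s hw hs => ?_⟩
  · rw [Real.sqrt_lt' one_pos]; simpa using hq1
  rw [Real.sq_sqrt hq0, hKκ, mul_assoc]
  have hs0 : 0 ≤ s := le_trans (by positivity) hs
  have hKw : 0 ≤ K * w := by positivity
  set p := 1 - Real.exp (-(K * w)) with hp
  have hp0 : 0 ≤ p := by
    have := Real.exp_le_one_iff.2 (neg_nonpos.2 hKw); linarith
  rcases lt_or_ge s R with hsR | hsR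
  · have hwT : K * w ≤ T := by
      rw [hT]
      gcongr
      rw [le_div_iff₀ hε]; linarith
    have h1 := one_sub_exp_neg_mul_le hκ0 hκ1.le hKw hwT
    have h2 : 1 + β * (s / 2 + 2 * C) ≤ (1 + δ) * (1 + β * s) := by
      have : 0 ≤ δ * (β * s) := by positivity
      have : 0 ≤ β * s := by positivity
      nlinarith
    calc (1 - Real.exp (-(κ * (K * w)))) * (1 + β * (s / 2 + 2 * C))
        ≤ ((1 - δ) * p) * ((1 + δ) * (1 + β * s)) :=
          mul_le_mul h1 h2 (by positivity) (mul_nonneg (by linarith) hp0)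
      _ = (1 - δ ^ 2) * (p * (1 + β * s)) := by ring
      _ ≤ q * (p * (1 + β * s)) := by
          gcongr
          exact le_max_left _ _
  · have h1 : 1 - Real.exp (-(κ * (K * w))) ≤ p := by
      have : Real.exp (-(K * w)) ≤ Real.exp (-(κ * (K * w))) := Real.exp_le_exp.2 (by nlinarith)
      rw [hp]; linarith
    have h2 : 1 + β * (s / 2 + 2 * C) ≤ γ * (1 + β * s) := by
      have h3 : (β * R / 4) / (1 + β * R) * (1 + β * s) ≤ β * s / 4 := by
        rw [div_mul_eq_mul_div, div_le_iff₀ (by positivity)]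
        nlinarith
      have h4 : β * (2 * C) ≤ β * (s / 4) := by gcongr; linarith
      rw [hγ]
      nlinarith
    calc (1 - Real.exp (-(κ * (K * w)))) * (1 + β * (s / 2 + 2 * C))
        ≤ p * (γ * (1 + β * s)) := mul_le_mul h1 h2 (by positivity) hp0
      _ = γ * (p * (1 + β * s)) := by ring
      _ ≤ q * (p * (1 + β * s)) := by
          gcongr
          exact le_max_right _ _

/-- Beyond `x₀` the factor `exp ((1 - ρ) x)` exceeds `2 A`; below it the left side is at most its
value at `x₀`. -/
theorem exists_mul_exp_le_half_exp_add {A ρ : ℝ} (hA : 0 < A) (hρ0 : 0 ≤ ρ) (hρ1 : ρ < 1) :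
    ∃ C : ℝ≥0, ∀ x : ℝ, A * Real.exp (ρ * x) ≤ Real.exp x / 2 + C := by
  set x₀ := Real.log (2 * A) / (1 - ρ) with hx₀
  have h1ρ : 0 < 1 - ρ := by linarith
  refine ⟨(A * Real.exp (ρ * x₀)).toNNReal, fun x => ?_⟩
  rw [Real.coe_toNNReal _ (by positivity)]
  rcases le_total x x₀ with h | h
  · have : A * Real.exp (ρ * x) ≤ A * Real.exp (ρ * x₀) := by gcongr
    have := Real.exp_pos x
    linarith
  · have h2 : 2 * A ≤ Real.exp ((1 - ρ) * x) := by
      rw [← Real.log_le_iff_le_exp (by positivity), ← div_le_iff₀' h1ρ]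
      exact h
    have h3 : Real.exp x = Real.exp ((1 - ρ) * x) * Real.exp (ρ * x) := by
      rw [← Real.exp_add]; congr 1; ring
    have h4 := mul_le_mul_of_nonneg_right h2 (Real.exp_pos (ρ * x)).le
    have : 0 ≤ A * Real.exp (ρ * x₀) := by positivity
    rw [← h3] at h4
    linarith

end RealInequalities

/-! ### Exponential drift of the intensity -/

theorem lintegral_exp_poissonMeasure (l : ℝ≥0) (t : ℝ) :
    ∫⁻ y, ENNReal.ofReal (Real.exp (t * y)) ∂poissonMeasure l
      = ENNReal.ofReal (Real.exp (l * (Real.exp t - 1))) := by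
  rw [poissonMeasure, lintegral_sum_measure]
  simp only [lintegral_smul_measure, lintegral_dirac, smul_eq_mul]
  have hterm : ∀ n : ℕ, ENNReal.ofReal (Real.exp (-l) * l ^ n / n.factorial)
      * ENNReal.ofReal (Real.exp (t * n))
      = ENNReal.ofReal (Real.exp (-l) * ((l * Real.exp t) ^ n / n.factorial)) := fun n => by
    rw [← ENNReal.ofReal_mul (by positivity), mul_pow, ← Real.exp_nat_mul, mul_comm t]
    congr 1
    ring
  simp_rw [hterm]
  have hs : HasSum (fun n : ℕ => Real.exp (-l) * ((l * Real.exp t) ^ n / n.factorial))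
      (Real.exp (-l) * Real.exp (l * Real.exp t)) := by
    have := NormedSpace.expSeries_div_hasSum_exp ((l : ℝ) * Real.exp t)
    rw [← Real.exp_eq_exp_ℝ] at this
    exact this.mul_left _
  rw [← ENNReal.ofReal_tsum_of_nonneg (fun n => by positivity) hs.summable, hs.tsum_eq,
    ← Real.exp_add]
  congr 2
  ring

namespace SetparParams

variable (θ : SetparParams)

/-- The new intensity as a function of the current state. -/
noncomputable def step (x : ℝ≥0 × ℕ) : ℝ≥0 := θ.nextIntensity x.1 x.2

theorem measurable_step : Measurable θ.step := θ.measurable_nextIntensity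

theorem lintegral_jointKernel (x : ℝ≥0 × ℕ) {g : ℝ≥0 × ℕ → ℝ≥0∞} (hg : Measurable g) :
    ∫⁻ z, g z ∂θ.jointKernel x = ∫⁻ y, g (θ.step x, y) ∂poissonMeasure (θ.step x) := by
  rw [jointKernel_apply, Measure.dirac_prod, lintegral_map hg (by fun_prop)]
  rfl

theorem kernelMean_jointKernel (x : ℝ≥0 × ℕ) {f : ℝ≥0 × ℕ → ℝ} (hf : Measurable f) :
    kernelMean θ.jointKernel f x = ∫ y, f (θ.step x, y) ∂poissonMeasure (θ.step x) := by
  rw [kernelMean, jointKernel_apply, Measure.dirac_prod,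
    integral_map (by fun_prop) hf.aestronglyMeasurable]
  rfl

/-- The larger of the two autoregressive coefficients of the intensity. -/
noncomputable def maxCoeff : ℝ := max θ.a₁ θ.a₂

theorem abs_nextIntensity_sub_le (u v : ℝ≥0) (y : ℕ) :
    |(θ.nextIntensity u y : ℝ) - θ.nextIntensity v y| ≤ θ.maxCoeff * |(u : ℝ) - v| := by
  unfold nextIntensity maxCoeff
  split_ifs
  · push_cast
    rw [show (θ.d₁ + θ.a₁ * u + θ.b₁ * y - (θ.d₁ + θ.a₁ * v + θ.b₁ * y) : ℝ)
      = θ.a₁ * (u - v) by ring, abs_mul, abs_of_nonneg θ.a₁.coe_nonneg]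
    gcongr
    exact le_max_left _ _
  · push_cast
    rw [show (θ.d₂ + θ.a₂ * u + θ.b₂ * y - (θ.d₂ + θ.a₂ * v + θ.b₂ * y) : ℝ)
      = θ.a₂ * (u - v) by ring, abs_mul, abs_of_nonneg θ.a₂.coe_nonneg]
    gcongr
    exact le_max_right _ _

/-- An exponential function of the intensity is a Lyapunov function. -/
theorem exists_exp_drift (ha₁ : θ.a₁ < 1) (hab₂ : θ.a₂ + θ.b₂ < 1) :
    ∃ ε : ℝ, 0 < ε ∧ ∃ C : ℝ≥0, ∀ l : ℝ≥0,
      ∫⁻ y, ENNReal.ofReal (Real.exp (ε * θ.nextIntensity l y)) ∂poissonMeasure l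
        ≤ ENNReal.ofReal (Real.exp (ε * l)) / 2 + C := by
  have ha₁' : (θ.a₁ : ℝ) < 1 := by exact_mod_cast ha₁
  have hab₂' : (θ.a₂ : ℝ) + θ.b₂ < 1 := by exact_mod_cast hab₂
  have hb₂ : (0 : ℝ) < θ.b₂ := by exact_mod_cast θ.b₂_pos
  set g := 1 - ((θ.a₂ : ℝ) + θ.b₂) with hg
  have hg0 : 0 < g := by rw [hg]; linarith
  -- The first bound allows the quadratic estimate of `exp (ε b₂) - 1`; the second makes its
  -- quadratic term at most `ε g / 2`. The upper regime then has exponent at most `a₂ + b₂ + g / 2 =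
  -- 1 - g / 2`, times `ε l`.
  set ε : ℝ := min (1 / θ.b₂) (g / (2 * (θ.b₂ : ℝ) ^ 2)) with hε
  have hε0 : 0 < ε := lt_min (by positivity) (by positivity)
  have hεb : ε * θ.b₂ ≤ 1 := by
    have := min_le_left (1 / (θ.b₂ : ℝ)) (g / (2 * (θ.b₂ : ℝ) ^ 2))
    rwa [← hε, le_div_iff₀ hb₂] at this
  have hεb2 : ε * (θ.b₂ : ℝ) ^ 2 ≤ g / 2 := by
    have := min_le_right (1 / (θ.b₂ : ℝ)) (g / (2 * (θ.b₂ : ℝ) ^ 2))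
    rw [← hε, le_div_iff₀ (by positivity)] at this
    linarith
  have hexp : Real.exp (ε * θ.b₂) - 1 ≤ ε * θ.b₂ + (ε * θ.b₂) ^ 2 := by
    have := (abs_le.1 (Real.abs_exp_sub_one_sub_id_le (x := ε * θ.b₂)
      (by rw [abs_of_nonneg (by positivity)]; exact hεb))).2
    linarith
  set ρ : ℝ := max θ.a₁ (1 - g / 2) with hρ
  have hρ1 : ρ < 1 := max_lt ha₁' (by linarith)
  have hρ0 : 0 ≤ ρ := le_max_of_le_left θ.a₁.coe_nonneg
  set A₁ := Real.exp (ε * (θ.d₁ + θ.b₁ * θ.r)) with hA₁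
  set A₂ := Real.exp (ε * θ.d₂) with hA₂
  obtain ⟨C, hC⟩ := exists_mul_exp_le_half_exp_add (A := A₁ + A₂) (by positivity) hρ0 hρ1
  refine ⟨ε, hε0, C, fun l => ?_⟩
  -- The two regimes are simply added. In the lower one `y ≤ r`, so `b₁` enters only through the
  -- constant `A₁`.
  have hpt : ∀ y : ℕ, Real.exp (ε * θ.nextIntensity l y)
      ≤ A₁ * Real.exp (ε * θ.a₁ * l)
        + A₂ * Real.exp (ε * θ.a₂ * l) * Real.exp (ε * θ.b₂ * y) := by
    intro y
    unfold nextIntensity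
    split_ifs with hy
    · refine le_add_of_le_of_nonneg ?_ (by positivity)
      rw [hA₁, ← Real.exp_add, Real.exp_le_exp]
      push_cast
      have : (θ.b₁ : ℝ) * y ≤ θ.b₁ * θ.r := by gcongr
      nlinarith
    · refine le_add_of_nonneg_of_le (by positivity) (le_of_eq ?_)
      rw [hA₂, ← Real.exp_add, ← Real.exp_add]
      push_cast
      congr 1
      ring
  calc ∫⁻ y, ENNReal.ofReal (Real.exp (ε * θ.nextIntensity l y)) ∂poissonMeasure l
      ≤ ∫⁻ y : ℕ, (ENNReal.ofReal (A₁ * Real.exp (ε * θ.a₁ * l))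
          + ENNReal.ofReal (A₂ * Real.exp (ε * θ.a₂ * l))
            * ENNReal.ofReal (Real.exp (ε * θ.b₂ * y))) ∂poissonMeasure l := by
        refine lintegral_mono fun y => ?_
        rw [← ENNReal.ofReal_mul (by positivity), ← ENNReal.ofReal_add (by positivity)
          (by positivity)]
        exact ENNReal.ofReal_le_ofReal (hpt y)
    _ = ENNReal.ofReal (A₁ * Real.exp (ε * θ.a₁ * l)
          + A₂ * Real.exp (ε * θ.a₂ * l) * Real.exp (l * (Real.exp (ε * θ.b₂) - 1))) := by
        rw [lintegral_add_left measurable_const, lintegral_const_mul _ (measurable_of_countable _),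
          lintegral_exp_poissonMeasure, ENNReal.ofReal_add (by positivity) (by positivity),
          ← ENNReal.ofReal_mul (by positivity)]
        simp
    _ ≤ ENNReal.ofReal (Real.exp (ε * l) / 2 + C) := by
        refine ENNReal.ofReal_le_ofReal (le_trans ?_ (hC (ε * l)))
        have hl : (0 : ℝ) ≤ l := l.coe_nonneg
        have hρ₁ : (θ.a₁ : ℝ) ≤ ρ := le_max_left _ _
        have hρ₂ : 1 - g / 2 ≤ ρ := le_max_right _ _
        have h1 : (l : ℝ) * (Real.exp (ε * θ.b₂) - 1) ≤ l * (ε * (θ.b₂ + g / 2)) := by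
          gcongr
          nlinarith
        have h2 : Real.exp (ε * θ.a₁ * l) ≤ Real.exp (ρ * (ε * l)) :=
          Real.exp_le_exp.2 (by nlinarith [mul_nonneg hε0.le hl])
        have h3 : Real.exp (ε * θ.a₂ * l) * Real.exp (l * (Real.exp (ε * θ.b₂) - 1))
            ≤ Real.exp (ρ * (ε * l)) := by
          rw [← Real.exp_add]
          exact Real.exp_le_exp.2 (by nlinarith [mul_nonneg hε0.le hl])
        rw [add_mul, mul_assoc A₂]
        exact add_le_add (mul_le_mul_of_nonneg_left h2 (Real.exp_pos _).le)
          (mul_le_mul_of_nonneg_left h3 (Real.exp_pos _).le)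
    _ = ENNReal.ofReal (Real.exp (ε * l)) / 2 + C := by
        rw [ENNReal.ofReal_add (by positivity) C.coe_nonneg,
          ENNReal.ofReal_div_of_pos two_pos, ENNReal.ofReal_coe_nnreal, ENNReal.ofReal_ofNat]

end SetparParams

/-! ### The weighted distance and its contraction under coupling -/

/-- A bounded distance on intensities, weighted by an exponential Lyapunov function. -/
noncomputable def intensityDist (ε β K : ℝ) (u v : ℝ≥0) : ℝ :=
  Real.sqrt (1 - Real.exp (-(K * |(u : ℝ) - v|)))
    * Real.sqrt (1 + β * (Real.exp (ε * u) + Real.exp (ε * v)))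

theorem intensityDist_nonneg (ε β K : ℝ) (u v : ℝ≥0) : 0 ≤ intensityDist ε β K u v :=
  mul_nonneg (Real.sqrt_nonneg _) (Real.sqrt_nonneg _)

theorem intensityDist_comm (ε β K : ℝ) (u v : ℝ≥0) :
    intensityDist ε β K u v = intensityDist ε β K v u := by
  unfold intensityDist
  rw [abs_sub_comm, add_comm (Real.exp (ε * u))]

theorem intensityDist_le {ε β K : ℝ} (hβ : 0 ≤ β) (u v : ℝ≥0) :
    intensityDist ε β K u v ≤ 1 + β * (Real.exp (ε * u) + Real.exp (ε * v)) := by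
  have h1 : Real.sqrt (1 - Real.exp (-(K * |(u : ℝ) - v|))) ≤ 1 := by
    refine Real.sqrt_le_iff.2 ⟨zero_le_one, ?_⟩
    linarith [Real.exp_pos (-(K * |(u : ℝ) - v|))]
  have h2 : 1 ≤ 1 + β * (Real.exp (ε * u) + Real.exp (ε * v)) :=
    le_add_of_nonneg_right (by positivity)
  calc intensityDist ε β K u v
      ≤ 1 * Real.sqrt (1 + β * (Real.exp (ε * u) + Real.exp (ε * v))) :=
        mul_le_mul_of_nonneg_right h1 (Real.sqrt_nonneg _)
    _ ≤ _ := by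
        rw [one_mul, Real.sqrt_le_left (by linarith)]
        nlinarith

theorem continuous_intensityDist (ε β K : ℝ) (u : ℝ≥0) : Continuous (intensityDist ε β K u) := by
  unfold intensityDist
  fun_prop

theorem intensityDist_self (ε β K : ℝ) (u : ℝ≥0) : intensityDist ε β K u u = 0 := by
  simp [intensityDist]

theorem min_one_abs_sub_le_intensityDist {ε β K : ℝ} (hβ : 0 ≤ β) (hK : 1 ≤ K) (u v : ℝ≥0) :
    min 1 |(u : ℝ) - v| ≤ 2 * intensityDist ε β K u v := by
  set w := |(u : ℝ) - v| with hw
  have hw0 : 0 ≤ w := abs_nonneg _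
  set p := 1 - Real.exp (-(K * w)) with hp
  have h1 : 1 - Real.exp (-w) ≤ p := by
    have : Real.exp (-(K * w)) ≤ Real.exp (-w) := Real.exp_le_exp.2 (by nlinarith)
    rw [hp]; linarith
  have hp0 : 0 ≤ p := by
    have := Real.exp_le_one_iff.2 (neg_nonpos.2 (mul_nonneg (zero_le_one.trans hK) hw0))
    linarith
  have hp1 : p ≤ 1 := by linarith [Real.exp_pos (-(K * w))]
  have h2 : p ≤ Real.sqrt p := Real.le_sqrt_of_sq_le (by nlinarith)
  have h3 : 1 ≤ Real.sqrt (1 + β * (Real.exp (ε * u) + Real.exp (ε * v))) :=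
    Real.one_le_sqrt.2 (le_add_of_nonneg_right (by positivity))
  have h4 : Real.sqrt p ≤ intensityDist ε β K u v :=
    le_mul_of_one_le_right (Real.sqrt_nonneg _) h3
  linarith [min_one_le_two_mul_one_sub_exp_neg hw0]

/-- Cauchy–Schwarz: the bounded factor and the Lyapunov factor of the distance can be estimated
separately under the coupling. -/
theorem lintegral_sqrt_mul_sqrt_le {α : Type*} [MeasurableSpace α] (μ : Measure α) {f g : α → ℝ}
    (hf : Measurable f) (hg : Measurable g) (hf0 : ∀ x, 0 ≤ f x) (hg0 : ∀ x, 0 ≤ g x) {p q : ℝ}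
    (hfp : ∫⁻ x, ENNReal.ofReal (f x) ∂μ ≤ ENNReal.ofReal p)
    (hgq : ∫⁻ x, ENNReal.ofReal (g x) ∂μ ≤ ENNReal.ofReal q) :
    ∫⁻ x, ENNReal.ofReal (Real.sqrt (f x) * Real.sqrt (g x)) ∂μ
      ≤ ENNReal.ofReal (Real.sqrt p * Real.sqrt q) := by
  have hsq : ∀ {r : ℝ}, 0 ≤ r → ENNReal.ofReal (Real.sqrt r) ^ (2 : ℝ) = ENNReal.ofReal r := by
    intro r hr
    rw [ENNReal.rpow_ofNat, ← ENNReal.ofReal_pow (Real.sqrt_nonneg _), Real.sq_sqrt hr]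
  have hroot : ∀ r : ℝ, ENNReal.ofReal r ^ (1 / 2 : ℝ) = ENNReal.ofReal (Real.sqrt r) := by
    intro r
    rcases le_total 0 r with hr | hr
    · rw [Real.sqrt_eq_rpow, ENNReal.ofReal_rpow_of_nonneg hr (by norm_num)]
    · rw [ENNReal.ofReal_of_nonpos hr, Real.sqrt_eq_zero_of_nonpos hr]
      simp
  have h := ENNReal.lintegral_mul_le_Lp_mul_Lq μ Real.HolderConjugate.two_two
    (f := fun x => ENNReal.ofReal (Real.sqrt (f x)))
    (g := fun x => ENNReal.ofReal (Real.sqrt (g x)))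
    (by fun_prop) (by fun_prop)
  simp only [Pi.mul_apply, hsq (hf0 _), hsq (hg0 _)] at h
  calc ∫⁻ x, ENNReal.ofReal (Real.sqrt (f x) * Real.sqrt (g x)) ∂μ
      = ∫⁻ x, ENNReal.ofReal (Real.sqrt (f x)) * ENNReal.ofReal (Real.sqrt (g x)) ∂μ :=
        lintegral_congr fun x => ENNReal.ofReal_mul (Real.sqrt_nonneg _)
    _ ≤ (ENNReal.ofReal p) ^ (1 / 2 : ℝ) * (ENNReal.ofReal q) ^ (1 / 2 : ℝ) := h.trans (by gcongr)
    _ = _ := by rw [hroot, hroot, ENNReal.ofReal_mul (Real.sqrt_nonneg _)]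

/-- The sum of independent Poisson variables is Poisson. -/
theorem map_add_prod_poissonMeasure (u w : ℝ≥0) :
    ((poissonMeasure u).prod (poissonMeasure w)).map (fun p : ℕ × ℕ => p.1 + p.2)
      = poissonMeasure (u + w) := by
  rw [← poissonMeasure_conv_poissonMeasure]
  rfl

theorem map_fst_prod_poissonMeasure (u w : ℝ≥0) :
    ((poissonMeasure u).prod (poissonMeasure w)).map Prod.fst = poissonMeasure u := by
  simp

theorem prod_poissonMeasure_real_snd_eq_zero (u w : ℝ≥0) :
    ((poissonMeasure u).prod (poissonMeasure w)).real {p | p.2 = 0} = Real.exp (-w) := by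
  have : {p : ℕ × ℕ | p.2 = 0} = Set.univ ×ˢ {0} := by ext; simp
  rw [this, measureReal_prod_prod, poissonMeasure_real_singleton]
  simp

namespace SetparParams

variable (θ : SetparParams)

theorem maxCoeff_nonneg : 0 ≤ θ.maxCoeff := le_max_of_le_left θ.a₁.coe_nonneg

/-- When the extra count vanishes, which has probability `exp (-w)`, both copies share count and
regime and their distance is at most `maxCoeff * w`. On the complement the integrand is bounded by
1. -/
theorem lintegral_coupled_bounded_le (u w : ℝ≥0) {K : ℝ} (hK : 0 ≤ K) :
    ∫⁻ p : ℕ × ℕ, ENNReal.ofReal (1 - Real.exp (-(K *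
        |(θ.nextIntensity u p.1 : ℝ) - θ.nextIntensity (u + w) (p.1 + p.2)|)))
        ∂(poissonMeasure u).prod (poissonMeasure w)
      ≤ ENNReal.ofReal (1 - Real.exp (-((1 + K * θ.maxCoeff) * w))) := by
  set m := (poissonMeasure u).prod (poissonMeasure w) with hm
  set c := Real.exp (-(K * (θ.maxCoeff * w))) with hc
  have hc1 : c ≤ 1 := Real.exp_le_one_iff.2
    (neg_nonpos.2 (mul_nonneg hK (mul_nonneg θ.maxCoeff_nonneg w.coe_nonneg)))
  set A : Set (ℕ × ℕ) := {p | p.2 = 0} with hA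
  have hAm : MeasurableSet A := .of_discrete
  have hpt : ∀ p : ℕ × ℕ, 1 - Real.exp (-(K *
        |(θ.nextIntensity u p.1 : ℝ) - θ.nextIntensity (u + w) (p.1 + p.2)|))
      ≤ 1 - A.indicator (fun _ => c) p := by
    intro p
    by_cases hp : p ∈ A
    · have hp' : p.2 = 0 := hp
      rw [Set.indicator_of_mem hp, hp', add_zero, hc]
      have h := θ.abs_nextIntensity_sub_le u (u + w) p.1
      have hw : |(u : ℝ) - (u + w : ℝ≥0)| = w := by
        push_cast
        rw [sub_add_cancel_left, abs_neg, abs_of_nonneg w.coe_nonneg]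
      rw [hw] at h
      gcongr
    · rw [Set.indicator_of_notMem hp]
      have := Real.exp_pos (-(K *
        |(θ.nextIntensity u p.1 : ℝ) - θ.nextIntensity (u + w) (p.1 + p.2)|))
      linarith
  have hint : Integrable (fun p => 1 - A.indicator (fun _ => c) p) m :=
    (integrable_const 1).sub ((integrable_const c).indicator hAm)
  have h0 : ∀ p, 0 ≤ 1 - A.indicator (fun _ => c) p := fun p => by
    by_cases hp : p ∈ A
    · rw [Set.indicator_of_mem hp]; linarith
    · rw [Set.indicator_of_notMem hp]; norm_num
  refine (lintegral_mono fun p => ENNReal.ofReal_le_ofReal (hpt p)).trans ?_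
  rw [← ofReal_integral_eq_lintegral_ofReal hint (ae_of_all _ h0),
    integral_sub (integrable_const 1) ((integrable_const c).indicator hAm),
    integral_indicator_const _ hAm, hA, hm, prod_poissonMeasure_real_snd_eq_zero]
  refine le_of_eq ?_
  simp only [integral_const, probReal_univ, smul_eq_mul, mul_one, hc]
  rw [← Real.exp_add]
  congr 3
  ring

/-- The weight is a sum over the two copies, so only the marginals matter; these are Poisson with
means `u` and `u + w`, and the drift applies to each. -/
theorem lintegral_coupled_weight_le {ε β : ℝ} (hβ : 0 ≤ β) {C : ℝ≥0}
    (hdrift : ∀ l : ℝ≥0,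
      ∫⁻ y, ENNReal.ofReal (Real.exp (ε * θ.nextIntensity l y)) ∂poissonMeasure l
        ≤ ENNReal.ofReal (Real.exp (ε * l)) / 2 + C) (u w : ℝ≥0) :
    ∫⁻ p : ℕ × ℕ, ENNReal.ofReal (1 + β * (Real.exp (ε * θ.nextIntensity u p.1)
        + Real.exp (ε * θ.nextIntensity (u + w) (p.1 + p.2))))
        ∂(poissonMeasure u).prod (poissonMeasure w)
      ≤ ENNReal.ofReal (1 + β * ((Real.exp (ε * u) + Real.exp (ε * (u + w : ℝ≥0))) / 2
        + 2 * C)) := by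
  set m := (poissonMeasure u).prod (poissonMeasure w) with hm
  have hreal : ∀ l : ℝ≥0, ENNReal.ofReal (Real.exp (ε * l)) / 2 + C
      = ENNReal.ofReal (Real.exp (ε * l) / 2 + C) := fun l => by
    rw [ENNReal.ofReal_add (by positivity) C.coe_nonneg, ENNReal.ofReal_div_of_pos two_pos,
      ENNReal.ofReal_coe_nnreal, ENNReal.ofReal_ofNat]
  have h1 : ∫⁻ p : ℕ × ℕ, ENNReal.ofReal (Real.exp (ε * θ.nextIntensity u p.1)) ∂m
      ≤ ENNReal.ofReal (Real.exp (ε * u) / 2 + C) := by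
    rw [← hreal]
    refine le_trans (le_of_eq ?_) (hdrift u)
    conv_rhs => rw [← map_fst_prod_poissonMeasure u w]
    rw [lintegral_map (measurable_of_countable _) measurable_fst]
  have h2 : ∫⁻ p : ℕ × ℕ, ENNReal.ofReal (Real.exp (ε * θ.nextIntensity (u + w) (p.1 + p.2))) ∂m
      ≤ ENNReal.ofReal (Real.exp (ε * (u + w : ℝ≥0)) / 2 + C) := by
    rw [← hreal]
    refine le_trans (le_of_eq ?_) (hdrift (u + w))
    conv_rhs => rw [← map_add_prod_poissonMeasure u w]
    rw [lintegral_map (measurable_of_countable _) (measurable_of_countable _)]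
  have h3 : ∀ p : ℕ × ℕ, ENNReal.ofReal (1 + β * (Real.exp (ε * θ.nextIntensity u p.1)
        + Real.exp (ε * θ.nextIntensity (u + w) (p.1 + p.2))))
      = 1 + ENNReal.ofReal β * (ENNReal.ofReal (Real.exp (ε * θ.nextIntensity u p.1))
        + ENNReal.ofReal (Real.exp (ε * θ.nextIntensity (u + w) (p.1 + p.2)))) := fun p => by
    rw [ENNReal.ofReal_add zero_le_one (by positivity), ENNReal.ofReal_one,
      ENNReal.ofReal_mul hβ, ENNReal.ofReal_add (by positivity) (by positivity)]
  simp_rw [h3]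
  rw [lintegral_add_left measurable_const, lintegral_const_mul _ (measurable_of_countable _),
    lintegral_add_left (measurable_of_countable _), lintegral_const, measure_univ, mul_one]
  calc _ ≤ 1 + ENNReal.ofReal β * (ENNReal.ofReal (Real.exp (ε * u) / 2 + C)
          + ENNReal.ofReal (Real.exp (ε * (u + w : ℝ≥0)) / 2 + C)) := by gcongr
    _ = _ := by
        rw [← ENNReal.ofReal_add (by positivity) (by positivity), ← ENNReal.ofReal_mul hβ,
          ← ENNReal.ofReal_one, ← ENNReal.ofReal_add zero_le_one (by positivity)]
        congr 1
        ring

/-- Under the coupling of two Poisson counts that shares their common part, the weighted distance of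
the intensities contracts. -/
theorem exists_coupling_contraction (ha₁ : θ.a₁ < 1) (hab₂ : θ.a₂ + θ.b₂ < 1) :
    ∃ (ε β K α : ℝ) (C : ℝ≥0), 0 < ε ∧ 0 < β ∧ 1 ≤ K ∧ 0 ≤ α ∧ α < 1 ∧
      (∀ l : ℝ≥0, ∫⁻ y, ENNReal.ofReal (Real.exp (ε * θ.nextIntensity l y)) ∂poissonMeasure l
        ≤ ENNReal.ofReal (Real.exp (ε * l)) / 2 + C) ∧
      ∀ u w : ℝ≥0, ∫⁻ p : ℕ × ℕ, ENNReal.ofReal (intensityDist ε β K (θ.nextIntensity u p.1)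
          (θ.nextIntensity (u + w) (p.1 + p.2))) ∂(poissonMeasure u).prod (poissonMeasure w)
        ≤ ENNReal.ofReal (α * intensityDist ε β K u (u + w)) := by
  obtain ⟨ε, hε, C, hdrift⟩ := θ.exists_exp_drift ha₁ hab₂
  have ha1 : θ.maxCoeff < 1 := max_lt (by exact_mod_cast ha₁)
    (by exact_mod_cast lt_of_le_of_lt le_self_add hab₂)
  have ha0 := θ.maxCoeff_nonneg
  obtain ⟨β, α, hβ, hα0, hα1, hβα⟩ := exists_contracting_weight hε ha0 ha1 C.coe_nonneg
  set K := 2 / (1 - θ.maxCoeff) with hK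
  have hK1 : 1 ≤ K := by rw [hK, one_le_div (by linarith)]; linarith
  refine ⟨ε, β, K, α, C, hε, hβ, hK1, hα0, hα1, hdrift, fun u w => ?_⟩
  have hexp : ∀ t : ℝ, 0 ≤ 1 - Real.exp (-(K * |t|)) := fun t => by
    have := Real.exp_le_one_iff.2 (neg_nonpos.2 (mul_nonneg (zero_le_one.trans hK1) (abs_nonneg t)))
    linarith
  refine (lintegral_sqrt_mul_sqrt_le _ (measurable_of_countable _) (measurable_of_countable _)
    (fun p => hexp _) (fun p => by positivity)
    (θ.lintegral_coupled_bounded_le u w (zero_le_one.trans hK1))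
    (θ.lintegral_coupled_weight_le hβ.le hdrift u w)).trans ?_
  refine ENNReal.ofReal_le_ofReal ?_
  have hw : |(u : ℝ) - (u + w : ℝ≥0)| = w := by
    push_cast
    rw [sub_add_cancel_left, abs_neg, abs_of_nonneg w.coe_nonneg]
  -- A large separation forces a large weight; this is what links the two cases of
  -- `exists_contracting_weight`.
  have hs : ε * w ≤ Real.exp (ε * u) + Real.exp (ε * (u + w : ℝ≥0)) := by
    have h1 := Real.add_one_le_exp (ε * (u + w : ℝ≥0))
    have h2 := Real.exp_pos (ε * u)
    push_cast at h1 ⊢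
    nlinarith [mul_nonneg hε.le u.coe_nonneg]
  have h := hβα w _ w.coe_nonneg hs
  have hq0 : 0 ≤ 1 - Real.exp (-((1 + K * θ.maxCoeff) * w)) := by
    have := Real.exp_le_one_iff.2 (neg_nonpos.2
      (show 0 ≤ (1 + K * θ.maxCoeff) * (w : ℝ) by positivity))
    linarith
  unfold intensityDist
  rw [← Real.sqrt_mul hq0, ← Real.sqrt_mul (hexp _), hw]
  refine Real.sqrt_le_iff.2 ⟨by positivity, ?_⟩
  rw [mul_pow, Real.sq_sqrt (mul_nonneg (by simpa using hexp w) (by positivity))]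
  exact h

/-- A difference of transition averages, estimated through the coupling. -/
theorem abs_kernelMean_sub_le_of_coupling {f : ℝ≥0 × ℕ → ℝ} (hf : Measurable f) {B : ℝ}
    (hB : ∀ x, |f x| ≤ B) {D : ℝ≥0 → ℝ≥0 → ℝ} (hD0 : ∀ u v, 0 ≤ D u v)
    (hDcomm : ∀ u v, D u v = D v u)
    (hD : ∀ u w : ℝ≥0, ∫⁻ p : ℕ × ℕ, ENNReal.ofReal |f (u, p.1) - f (u + w, p.1 + p.2)|
        ∂(poissonMeasure u).prod (poissonMeasure w) ≤ ENNReal.ofReal (D u (u + w)))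
    (x x' : ℝ≥0 × ℕ) :
    |kernelMean θ.jointKernel f x - kernelMean θ.jointKernel f x'| ≤ D (θ.step x) (θ.step x') := by
  wlog hle : θ.step x ≤ θ.step x' generalizing x x'
  · rw [abs_sub_comm, hDcomm]
    exact this x' x (le_of_not_ge hle)
  rw [θ.kernelMean_jointKernel x hf, θ.kernelMean_jointKernel x' hf]
  obtain ⟨w, hw⟩ := exists_add_of_le hle
  rw [hw]
  set u := θ.step x
  have hmeas : ∀ g : ℕ × ℕ → ℝ, Measurable g := fun g => measurable_of_countable _
  have hint : ∀ g : ℕ × ℕ → ℝ≥0 × ℕ, Integrable (fun p => f (g p))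
      ((poissonMeasure u).prod (poissonMeasure w)) := fun g =>
    integrable_of_abs_le (hmeas _) fun p => hB _
  have h1 : ∫ y, f (u, y) ∂poissonMeasure u
      = ∫ p : ℕ × ℕ, f (u, p.1) ∂(poissonMeasure u).prod (poissonMeasure w) := by
    conv_lhs => rw [← map_fst_prod_poissonMeasure u w]
    rw [integral_map (by fun_prop) (measurable_of_countable _).aestronglyMeasurable]
  have h2 : ∫ y, f (u + w, y) ∂poissonMeasure (u + w)
      = ∫ p : ℕ × ℕ, f (u + w, p.1 + p.2) ∂(poissonMeasure u).prod (poissonMeasure w) := by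
    conv_lhs => rw [← map_add_prod_poissonMeasure u w]
    rw [integral_map (measurable_of_countable _).aemeasurable
      (measurable_of_countable _).aestronglyMeasurable]
  rw [h1, h2, ← integral_sub (hint _) (hint _), ← Real.norm_eq_abs]
  refine (norm_integral_le_lintegral_norm _).trans ?_
  simp only [Real.norm_eq_abs]
  exact ENNReal.toReal_le_of_le_ofReal (hD0 _ _) (hD u w)

/-- One transition suffices to make a bounded Lipschitz function Lipschitz for the weighted distance
of next intensities: with equal counts `f` moves by at most `L w`, and the counts differ with
probability `1 - exp (-w) ≤ w`, at cost `2 B`. -/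
theorem abs_kernelMean_sub_le_of_lipschitz {ε β K : ℝ} (hβ : 0 ≤ β) (hK : 1 ≤ K)
    {f : ℝ≥0 × ℕ → ℝ} {B : ℝ} (hB : ∀ x, |f x| ≤ B) {L : ℝ≥0} (hL : LipschitzWith L f)
    (x x' : ℝ≥0 × ℕ) :
    |kernelMean θ.jointKernel f x - kernelMean θ.jointKernel f x'|
      ≤ 2 * (L + 2 * B) * intensityDist ε β K (θ.step x) (θ.step x') := by
  have hB0 : 0 ≤ B := (abs_nonneg _).trans (hB x)
  refine θ.abs_kernelMean_sub_le_of_coupling hL.continuous.measurable hB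
    (D := fun u v => 2 * (L + 2 * B) * intensityDist ε β K u v)
    (fun u v => mul_nonneg (by positivity) (intensityDist_nonneg _ _ _ _ _))
    (fun u v => by rw [intensityDist_comm]) (fun u w => ?_) x x'
  set m := (poissonMeasure u).prod (poissonMeasure w) with hm
  set A : Set (ℕ × ℕ) := {p | p.2 = 0} with hA
  have hAm : MeasurableSet A := .of_discrete
  have hf2 : ∀ y z, |f y - f z| ≤ 2 * B := fun y z =>
    (abs_sub _ _).trans (by linarith [hB y, hB z])
  have hdist : ∀ y : ℕ, |f (u, y) - f (u + w, y)| ≤ L * w := fun y => by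
    have := hL.dist_le_mul (u, y) (u + w, y)
    rw [Real.dist_eq, Prod.dist_eq] at this
    simpa [NNReal.dist_eq] using this
  have hbound : ∫⁻ p : ℕ × ℕ, ENNReal.ofReal |f (u, p.1) - f (u + w, p.1 + p.2)| ∂m
      ≤ ENNReal.ofReal ((L + 2 * B) * min 1 (w : ℝ)) := by
    have hint₁ : Integrable (A.indicator fun _ => (1 : ℝ)) m := (integrable_const 1).indicator hAm
    have hint₂ : Integrable (fun p => 2 * B * (1 - A.indicator (fun _ => 1) p)) m :=
      ((integrable_const 1).sub hint₁).const_mul _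
    have hint : Integrable (fun p => L * (w : ℝ) + 2 * B * (1 - A.indicator (fun _ => 1) p)) m :=
      (integrable_const _).add hint₂
    have hpt : ∀ p : ℕ × ℕ, |f (u, p.1) - f (u + w, p.1 + p.2)|
        ≤ L * (w : ℝ) + 2 * B * (1 - A.indicator (fun _ => 1) p) := by
      intro p
      by_cases hp : p ∈ A
      · have hp' : p.2 = 0 := hp
        rw [Set.indicator_of_mem hp, hp', add_zero, sub_self, mul_zero, add_zero]
        exact hdist _
      · rw [Set.indicator_of_notMem hp, sub_zero, mul_one]
        exact (hf2 _ _).trans (le_add_of_nonneg_left (by positivity))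
    rcases le_total 1 (w : ℝ) with hw | hw
    · rw [min_eq_left hw]
      calc _ ≤ ∫⁻ p : ℕ × ℕ, ENNReal.ofReal (L + 2 * B) ∂m :=
            lintegral_mono fun p => ENNReal.ofReal_le_ofReal
              ((hf2 _ _).trans (le_add_of_nonneg_left L.coe_nonneg))
        _ = _ := by simp [hm]
    · rw [min_eq_right hw]
      refine (lintegral_mono fun p => ENNReal.ofReal_le_ofReal (hpt p)).trans ?_
      rw [← ofReal_integral_eq_lintegral_ofReal hint
        (ae_of_all _ fun p => (abs_nonneg _).trans (hpt p))]
      refine ENNReal.ofReal_le_ofReal ?_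
      rw [integral_add (integrable_const _) hint₂, integral_const_mul (2 * B),
        integral_sub (integrable_const 1) hint₁,
        integral_indicator_const _ hAm, hA, hm, prod_poissonMeasure_real_snd_eq_zero]
      simp only [integral_const, probReal_univ, smul_eq_mul, mul_one, one_mul]
      have := Real.one_sub_le_exp_neg (w : ℝ)
      nlinarith
  refine hbound.trans (ENNReal.ofReal_le_ofReal ?_)
  have h := min_one_abs_sub_le_intensityDist (ε := ε) hβ hK u (u + w)
  have hw : |(u : ℝ) - (u + w : ℝ≥0)| = w := by
    push_cast
    rw [sub_add_cancel_left, abs_neg, abs_of_nonneg w.coe_nonneg]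
  rw [hw] at h
  calc (L + 2 * B) * min 1 (w : ℝ) ≤ (L + 2 * B) * (2 * intensityDist ε β K u (u + w)) := by gcongr
    _ = _ := by ring

/-- Integrating the Lipschitz bound under the coupling gains one factor `α`; this is the induction
step for iterated averages. -/
theorem abs_kernelMean_sub_le_of_intensityDist {ε β K α : ℝ}
    (hα : ∀ u w : ℝ≥0, ∫⁻ p : ℕ × ℕ, ENNReal.ofReal (intensityDist ε β K (θ.nextIntensity u p.1)
          (θ.nextIntensity (u + w) (p.1 + p.2))) ∂(poissonMeasure u).prod (poissonMeasure w)
        ≤ ENNReal.ofReal (α * intensityDist ε β K u (u + w))) (hα0 : 0 ≤ α)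
    {f : ℝ≥0 × ℕ → ℝ} (hf : Measurable f) {B : ℝ} (hB : ∀ x, |f x| ≤ B) {M : ℝ} (hM : 0 ≤ M)
    (hfM : ∀ x x', |f x - f x'| ≤ M * intensityDist ε β K (θ.step x) (θ.step x'))
    (x x' : ℝ≥0 × ℕ) :
    |kernelMean θ.jointKernel f x - kernelMean θ.jointKernel f x'|
      ≤ M * α * intensityDist ε β K (θ.step x) (θ.step x') := by
  refine θ.abs_kernelMean_sub_le_of_coupling hf hB
    (D := fun u v => M * α * intensityDist ε β K u v)
    (fun u v => mul_nonneg (by positivity) (intensityDist_nonneg _ _ _ _ _))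
    (fun u v => by rw [intensityDist_comm]) (fun u w => ?_) x x'
  calc _ ≤ ∫⁻ p : ℕ × ℕ, ENNReal.ofReal M * ENNReal.ofReal (intensityDist ε β K
          (θ.nextIntensity u p.1) (θ.nextIntensity (u + w) (p.1 + p.2)))
          ∂(poissonMeasure u).prod (poissonMeasure w) := by
        refine lintegral_mono fun p => ?_
        rw [← ENNReal.ofReal_mul hM]
        exact ENNReal.ofReal_le_ofReal (hfM _ _)
    _ ≤ ENNReal.ofReal M * ENNReal.ofReal (α * intensityDist ε β K u (u + w)) := by
        rw [lintegral_const_mul _ (measurable_of_countable _)]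
        gcongr
        exact hα u w
    _ = _ := by rw [← ENNReal.ofReal_mul hM, mul_assoc]

/-- Geometric contraction of the iterated transition averages. -/
theorem abs_iterate_kernelMean_sub_le {ε β K α : ℝ} (hβ : 0 ≤ β) (hK : 1 ≤ K)
    (hα : ∀ u w : ℝ≥0, ∫⁻ p : ℕ × ℕ, ENNReal.ofReal (intensityDist ε β K (θ.nextIntensity u p.1)
          (θ.nextIntensity (u + w) (p.1 + p.2))) ∂(poissonMeasure u).prod (poissonMeasure w)
        ≤ ENNReal.ofReal (α * intensityDist ε β K u (u + w))) (hα0 : 0 ≤ α)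
    {f : ℝ≥0 × ℕ → ℝ} {B : ℝ} (hB : ∀ x, |f x| ≤ B) {L : ℝ≥0} (hL : LipschitzWith L f)
    (n : ℕ) (x x' : ℝ≥0 × ℕ) :
    |(kernelMean θ.jointKernel)^[n + 1] f x - (kernelMean θ.jointKernel)^[n + 1] f x'|
      ≤ 2 * (L + 2 * B) * α ^ n * intensityDist ε β K (θ.step x) (θ.step x') := by
  have hB0 : 0 ≤ B := (abs_nonneg _).trans (hB x)
  have hfm := hL.continuous.measurable
  -- The first of the `n + 1` transitions is spent on passing from the original metric to the
  -- weighted distance, hence the exponent `n`.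
  induction n generalizing x x' with
  | zero => simpa using θ.abs_kernelMean_sub_le_of_lipschitz hβ hK hB hL x x'
  | succ n ih =>
    rw [Function.iterate_succ_apply', pow_succ, ← mul_assoc]
    exact θ.abs_kernelMean_sub_le_of_intensityDist hα hα0
      (measurable_iterate_kernelMean _ hfm _) (abs_iterate_kernelMean_le _ hB _) (by positivity)
      ih x x'

end SetparParams

/-! ### Existence of the invariant law, and stability -/

section IteratedLaw

variable {E : Type*} [MeasurableSpace E]

/-- The law after `n` transitions. -/
noncomputable def iteratedLaw (κ : Kernel E E) (ν : Measure E) : ℕ → Measure E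
  | 0 => ν
  | n + 1 => (iteratedLaw κ ν n).bind κ

theorem isProbabilityMeasure_iteratedLaw (κ : Kernel E E) [IsMarkovKernel κ] (ν : Measure E)
    [IsProbabilityMeasure ν] (n : ℕ) : IsProbabilityMeasure (iteratedLaw κ ν n) := by
  induction n with
  | zero => assumption
  | succ n ih => exact inferInstanceAs (IsProbabilityMeasure ((iteratedLaw κ ν n).bind κ))

theorem integral_iteratedLaw (κ : Kernel E E) [IsMarkovKernel κ] (ν : Measure E)
    [IsProbabilityMeasure ν] (n : ℕ) {f : E → ℝ} (hf : Measurable f) {B : ℝ}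
    (hB : ∀ x, |f x| ≤ B) :
    ∫ x, f x ∂iteratedLaw κ ν n = ∫ x, (kernelMean κ)^[n] f x ∂ν := by
  induction n generalizing f with
  | zero => rfl
  | succ n ih =>
    have := isProbabilityMeasure_iteratedLaw κ ν n
    rw [iteratedLaw, integral_bind_eq_integral_kernelMean κ _ hf hB,
      ih (measurable_kernelMean κ hf) (abs_kernelMean_le κ hB), Function.iterate_succ_apply]

theorem lintegral_iteratedLaw_le (κ : Kernel E E) [IsMarkovKernel κ] {W : E → ℝ}
    (hW : Measurable W) {C : ℝ≥0}
    (hdrift : ∀ x, ∫⁻ y, ENNReal.ofReal (W y) ∂κ x ≤ ENNReal.ofReal (W x) / 2 + C) (x : E) (n : ℕ) :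
    ∫⁻ y, ENNReal.ofReal (W y) ∂iteratedLaw κ (Measure.dirac x) n
      ≤ ENNReal.ofReal (W x) + 2 * C := by
  have hW' : Measurable fun y => ENNReal.ofReal (W y) := hW.ennreal_ofReal
  induction n with
  | zero =>
    rw [iteratedLaw, lintegral_dirac' _ hW']
    exact le_self_add
  | succ n ih =>
    have := isProbabilityMeasure_iteratedLaw κ (Measure.dirac x) n
    rw [iteratedLaw, Measure.lintegral_bind κ.aemeasurable hW'.aemeasurable]
    refine (lintegral_mono hdrift).trans ?_
    simp_rw [div_eq_mul_inv]
    rw [lintegral_add_right _ measurable_const, lintegral_mul_const _ hW', lintegral_const,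
      measure_univ, mul_one, ← div_eq_mul_inv]
    calc _ ≤ (ENNReal.ofReal (W x) + 2 * C) / 2 + C := by gcongr
      _ ≤ _ := by
        rw [ENNReal.add_div, mul_comm 2, ENNReal.mul_div_cancel_right two_ne_zero
          ENNReal.ofNat_ne_top, add_assoc, mul_two]
        gcongr
        exact ENNReal.half_le_self

end IteratedLaw

namespace SetparParams

variable (θ : SetparParams)

/-- The threshold creates no discontinuity, because the count lives in a discrete space. -/
theorem continuous_step : Continuous θ.step := by
  refine continuous_prod_of_discrete_right.2 fun y => ?_
  unfold step nextIntensity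
  by_cases h : y ≤ θ.r
  · simp only [h, if_true]; fun_prop
  · simp only [h, if_false]; fun_prop

/-- Positivity of all four slopes lets the next intensity dominate both coordinates, so a bound on
it confines the state to a compact set and its exponential moments control the count. -/
theorem exists_mul_le_step : ∃ c : ℝ, 0 < c ∧ ∀ x : ℝ≥0 × ℕ, c * (x.1 + x.2) ≤ θ.step x := by
  have h1 : (0 : ℝ) < θ.a₁ := by exact_mod_cast θ.a₁_pos
  have h2 : (0 : ℝ) < θ.a₂ := by exact_mod_cast θ.a₂_pos
  have h3 : (0 : ℝ) < θ.b₁ := by exact_mod_cast θ.b₁_pos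
  have h4 : (0 : ℝ) < θ.b₂ := by exact_mod_cast θ.b₂_pos
  refine ⟨min (min θ.a₁ θ.a₂) (min θ.b₁ θ.b₂), by positivity, fun x => ?_⟩
  set c : ℝ := min (min (θ.a₁ : ℝ) θ.a₂) (min (θ.b₁ : ℝ) θ.b₂)
  have hc1 : c ≤ θ.a₁ := (min_le_left _ _).trans (min_le_left _ _)
  have hc2 : c ≤ θ.a₂ := (min_le_left _ _).trans (min_le_right _ _)
  have hc3 : c ≤ θ.b₁ := (min_le_right _ _).trans (min_le_left _ _)
  have hc4 : c ≤ θ.b₂ := (min_le_right _ _).trans (min_le_right _ _)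
  have hx1 : (0 : ℝ) ≤ x.1 := x.1.coe_nonneg
  have hx2 : (0 : ℝ) ≤ x.2 := Nat.cast_nonneg _
  unfold step nextIntensity
  split_ifs
  · push_cast
    nlinarith [mul_le_mul_of_nonneg_right hc1 hx1, mul_le_mul_of_nonneg_right hc3 hx2,
      θ.d₁.coe_nonneg]
  · push_cast
    nlinarith [mul_le_mul_of_nonneg_right hc2 hx1, mul_le_mul_of_nonneg_right hc4 hx2,
      θ.d₂.coe_nonneg]

/-- The transition averages of a bounded Lipschitz function under a law and from a point. -/
theorem abs_integral_iterate_kernelMean_sub_le {ε β K α : ℝ} (hβ : 0 ≤ β) (hK : 1 ≤ K)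
    (hα : ∀ u w : ℝ≥0, ∫⁻ p : ℕ × ℕ, ENNReal.ofReal (intensityDist ε β K (θ.nextIntensity u p.1)
          (θ.nextIntensity (u + w) (p.1 + p.2))) ∂(poissonMeasure u).prod (poissonMeasure w)
        ≤ ENNReal.ofReal (α * intensityDist ε β K u (u + w))) (hα0 : 0 ≤ α)
    {f : ℝ≥0 × ℕ → ℝ} {B : ℝ} (hB : ∀ x, |f x| ≤ B) {L : ℝ≥0} (hL : LipschitzWith L f)
    {ρ : Measure (ℝ≥0 × ℕ)} [IsProbabilityMeasure ρ]
    (hρ : Integrable (fun x => Real.exp (ε * θ.step x)) ρ) (n : ℕ) (x : ℝ≥0 × ℕ) :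
    |(∫ y, (kernelMean θ.jointKernel)^[n + 1] f y ∂ρ) - (kernelMean θ.jointKernel)^[n + 1] f x|
      ≤ 2 * (L + 2 * B) * α ^ n
        * (1 + β * (Real.exp (ε * θ.step x) + ∫ y, Real.exp (ε * θ.step y) ∂ρ)) := by
  have hB0 : 0 ≤ B := (abs_nonneg _).trans (hB x)
  set g := (kernelMean θ.jointKernel)^[n + 1] f with hg
  have hgi : Integrable g ρ := integrable_of_abs_le
    (measurable_iterate_kernelMean _ hL.continuous.measurable _) (abs_iterate_kernelMean_le _ hB _)
  have h1 : (∫ y, g y ∂ρ) - g x = ∫ y, (g y - g x) ∂ρ := by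
    rw [integral_sub hgi (integrable_const _)]
    simp
  have hint : Integrable (fun y => 1 + β * (Real.exp (ε * θ.step x) + Real.exp (ε * θ.step y))) ρ :=
    (integrable_const 1).add (((integrable_const _).add hρ).const_mul β)
  have h2 : ∫ y, (1 + β * (Real.exp (ε * θ.step x) + Real.exp (ε * θ.step y))) ∂ρ
      = 1 + β * (Real.exp (ε * θ.step x) + ∫ y, Real.exp (ε * θ.step y) ∂ρ) := by
    have h3 : Integrable (fun y => Real.exp (ε * θ.step x) + Real.exp (ε * θ.step y)) ρ :=
      (integrable_const _).add hρ
    rw [integral_add (integrable_const 1) (h3.const_mul β), integral_const_mul,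
      integral_add (integrable_const _) hρ]
    simp
  rw [h1, ← h2, ← integral_const_mul]
  refine abs_integral_le_integral_abs.trans ?_
  refine integral_mono (hgi.sub (integrable_const _)).abs (hint.const_mul _) fun y => ?_
  simp only
  rw [abs_sub_comm]
  refine (θ.abs_iterate_kernelMean_sub_le hβ hK hα hα0 hB hL n x y).trans ?_
  gcongr
  exact intensityDist_le hβ _ _

/-- The weighted distance is continuous and vanishes on the diagonal. This Feller property allows
passing to the limit in the transition kernel. -/
theorem continuous_kernelMean {ε β K : ℝ} (hβ : 0 ≤ β) (hK : 1 ≤ K) {f : ℝ≥0 × ℕ → ℝ} {B : ℝ}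
    (hB : ∀ x, |f x| ≤ B) {L : ℝ≥0} (hL : LipschitzWith L f) :
    Continuous (kernelMean θ.jointKernel f) := by
  refine continuous_iff_continuousAt.2 fun x => tendsto_iff_dist_tendsto_zero.2 ?_
  have hlim : Tendsto (fun y => 2 * (L + 2 * B) * intensityDist ε β K (θ.step x) (θ.step y)) (𝓝 x)
      (𝓝 0) := by
    have := (((continuous_intensityDist ε β K (θ.step x)).comp θ.continuous_step).tendsto
      x).const_mul (2 * (L + 2 * B))
    simpa [intensityDist_self] using this
  refine squeeze_zero (fun y => dist_nonneg) (fun y => ?_) hlim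
  rw [dist_comm, Real.dist_eq]
  exact θ.abs_kernelMean_sub_le_of_lipschitz hβ hK hB hL x y

/-- Markov's inequality: outside the box of side `N` the sum of the coordinates is at least `N`, so
`exp (ε * step)` is at least `ε c N`. -/
theorem isTightMeasureSet_of_lintegral_exp_le {ε : ℝ} (hε : 0 < ε) {M : ℝ≥0∞} (hM : M ≠ ∞)
    {S : Set (Measure (ℝ≥0 × ℕ))}
    (hS : ∀ μ ∈ S, ∫⁻ x, ENNReal.ofReal (Real.exp (ε * θ.step x)) ∂μ ≤ M) :
    IsTightMeasureSet S := by
  obtain ⟨c, hc, hstep⟩ := θ.exists_mul_le_step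
  refine isTightMeasureSet_iff_exists_isCompact_measure_compl_le.2 fun δ hδ => ?_
  have hlim : Tendsto (fun N : ℕ => M / ENNReal.ofReal (ε * c * N)) atTop (𝓝 0) := by
    have h1 : Tendsto (fun N : ℕ => ENNReal.ofReal (ε * c * N)) atTop (𝓝 ∞) :=
      ENNReal.tendsto_ofReal_atTop.comp
        (tendsto_natCast_atTop_atTop.const_mul_atTop (mul_pos hε hc))
    have := ENNReal.Tendsto.const_div h1 (Or.inr hM)
    simpa using this
  obtain ⟨N, hNδ, hN0⟩ := ((hlim.eventually (ge_mem_nhds hδ)).and (eventually_gt_atTop 0)).exists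
  refine ⟨Set.Icc 0 (N : ℝ≥0) ×ˢ Set.Iic N, isCompact_Icc.prod (Set.finite_Iic N).isCompact,
    fun μ hμ => ?_⟩
  have hN0' : (0 : ℝ) < N := by exact_mod_cast hN0
  have hpos : (0 : ℝ) < ε * c * N := by positivity
  refine le_trans ?_ hNδ
  rw [ENNReal.le_div_iff_mul_le (Or.inl (ENNReal.ofReal_pos.2 hpos).ne')
    (Or.inl ENNReal.ofReal_ne_top), mul_comm]
  refine le_trans ?_ (hS μ hμ)
  refine le_trans (mul_le_mul_right (measure_mono fun x hx => ?_) _)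
    (mul_meas_ge_le_lintegral
      (Real.measurable_exp.comp (measurable_const.mul
        (measurable_coe_nnreal_real.comp θ.measurable_step))).ennreal_ofReal _)
  refine ENNReal.ofReal_le_ofReal ?_
  have h1 : (N : ℝ) ≤ x.1 + x.2 := by
    simp only [Set.mem_compl_iff, Set.mem_prod, Set.mem_Icc, zero_le, true_and, Set.mem_Iic,
      not_and_or, not_le] at hx
    rcases hx with hx | hx
    · have : (N : ℝ) < x.1 := by exact_mod_cast hx
      have : (0 : ℝ) ≤ x.2 := Nat.cast_nonneg _
      linarith
    · have : (N : ℝ) < x.2 := by exact_mod_cast hx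
      have : (0 : ℝ) ≤ x.1 := x.1.coe_nonneg
      linarith
  have h2 := hstep x
  have h3 := Real.add_one_le_exp (ε * θ.step x)
  have h4 : ε * (c * N) ≤ ε * θ.step x := by
    gcongr
    exact le_trans (by gcongr) h2
  change ε * c * N ≤ Real.exp (ε * θ.step x)
  linarith

/-- The joint chain has an invariant law with an exponential moment, and is stable. -/
theorem exists_invariant_isStableChain.{w} (ha₁ : θ.a₁ < 1) (hab₂ : θ.a₂ + θ.b₂ < 1) :
    ∃ (π : ProbabilityMeasure (ℝ≥0 × ℕ)) (ε : ℝ), 0 < ε ∧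
      Kernel.Invariant θ.jointKernel (π : Measure (ℝ≥0 × ℕ)) ∧
      Integrable (fun x => Real.exp (ε * θ.step x)) (π : Measure (ℝ≥0 × ℕ)) ∧
      IsStableChain.{w, 0} θ.jointKernel π := by
  obtain ⟨ε, β, K, α, C, hε, hβ, hK, hα0, hα1, hdrift₀, hα⟩ :=
    θ.exists_coupling_contraction ha₁ hab₂
  set κ := θ.jointKernel with hκ
  -- The Lyapunov function is evaluated at the next intensity, since the transition law depends on
  -- the state only through it.
  set W : ℝ≥0 × ℕ → ℝ := fun x => Real.exp (ε * θ.step x) with hWdef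
  have hWc : Continuous W := by
    have := θ.continuous_step
    fun_prop
  have hWm : Measurable W := hWc.measurable
  have hW0 : ∀ x, 0 ≤ W x := fun x => (Real.exp_pos _).le
  have hW1 : ∀ x, 1 ≤ W x := fun x =>
    Real.one_le_exp (mul_nonneg hε.le (θ.step x).coe_nonneg)
  have hdrift : ∀ x, ∫⁻ y, ENNReal.ofReal (W y) ∂κ x ≤ ENNReal.ofReal (W x) / 2 + C := fun x => by
    rw [hκ, θ.lintegral_jointKernel x hWm.ennreal_ofReal]
    exact hdrift₀ (θ.step x)
  have hint : ∀ {ρ : Measure (ℝ≥0 × ℕ)}, ∫⁻ x, ENNReal.ofReal (W x) ∂ρ < ∞ → Integrable W ρ :=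
    fun h => ⟨hWm.aestronglyMeasurable, by
      rwa [hasFiniteIntegral_iff_ofReal (ae_of_all _ hW0)]⟩
  let x₀ : ℝ≥0 × ℕ := (0, 0)
  have hκi : Integrable W (κ x₀) := hint <| (hdrift x₀).trans_lt <| by
    simp [ENNReal.add_lt_top, ENNReal.div_lt_top]
  set M : ℝ≥0∞ := ENNReal.ofReal (W x₀) + 2 * C with hMdef
  have hM : M ≠ ∞ := by
    rw [hMdef]
    exact ENNReal.add_ne_top.2 ⟨ENNReal.ofReal_ne_top,
      ENNReal.mul_ne_top ENNReal.ofNat_ne_top ENNReal.coe_ne_top⟩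
  let μ : ℕ → ProbabilityMeasure (ℝ≥0 × ℕ) := fun n =>
    ⟨iteratedLaw κ (Measure.dirac x₀) n, isProbabilityMeasure_iteratedLaw κ _ n⟩
  have hμM : ∀ n, ∫⁻ x, ENNReal.ofReal (W x) ∂(μ n : Measure (ℝ≥0 × ℕ)) ≤ M := fun n =>
    lintegral_iteratedLaw_le κ hWm hdrift x₀ n
  have htight : IsTightMeasureSet
      {((ρ : ProbabilityMeasure (ℝ≥0 × ℕ)) : Measure (ℝ≥0 × ℕ)) | ρ ∈ Set.range μ} := by
    refine θ.isTightMeasureSet_of_lintegral_exp_le hε hM ?_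
    rintro _ ⟨_, ⟨n, rfl⟩, rfl⟩
    exact hμM n
  obtain ⟨π, -, φ, hφ, hlim⟩ := (isCompact_closure_of_isTightMeasureSet htight).tendsto_subseq
    fun n => subset_closure (Set.mem_range_self n)
  have hμint : ∀ (n : ℕ) {f : ℝ≥0 × ℕ → ℝ} (_ : Measurable f) {B : ℝ} (_ : ∀ x, |f x| ≤ B),
      ∫ x, f x ∂(μ n : Measure (ℝ≥0 × ℕ)) = (kernelMean κ)^[n] f x₀ := fun n f hf B hB => by
    refine (integral_iteratedLaw κ (Measure.dirac x₀) n hf hB).trans ?_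
    exact integral_dirac' _ _ (measurable_iterate_kernelMean κ hf n).stronglyMeasurable
  -- The shifted laws along the subsequence have two limits: `π`, because consecutive laws merge on
  -- bounded Lipschitz functions, and `π` moved by one transition, by the Feller property.
  have hinv : Kernel.Invariant κ (π : Measure (ℝ≥0 × ℕ)) := by
    let π' : ProbabilityMeasure (ℝ≥0 × ℕ) := ⟨(π : Measure (ℝ≥0 × ℕ)).bind κ, inferInstance⟩
    have h1 : Tendsto (fun k => μ (φ k + 1)) atTop (𝓝 π) := by
      refine tendsto_iff_forall_lipschitz_integral_tendsto.2 fun f hf hL => ?_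
      have hfl := tendsto_iff_forall_lipschitz_integral_tendsto.1 hlim f hf hL
      obtain ⟨D, hD⟩ := hf
      obtain ⟨L, hL⟩ := hL
      have hfm := hL.continuous.measurable
      have hB : ∀ x, |f x| ≤ D + |f x₀| := fun x => by
        have := hD x x₀
        rw [Real.dist_eq] at this
        calc |f x| = |(f x - f x₀) + f x₀| := by rw [sub_add_cancel]
          _ ≤ |f x - f x₀| + |f x₀| := abs_add_le _ _
          _ ≤ _ := by linarith
      set B := D + |f x₀|
      have hdiff : Tendsto (fun n => ∫ x, f x ∂(μ (n + 1) : Measure (ℝ≥0 × ℕ))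
          - ∫ x, f x ∂(μ n : Measure (ℝ≥0 × ℕ))) atTop (𝓝 0) := by
        -- The contraction concerns `n + 1` transitions. One more transition from `x₀` is an average
        -- of the starting point over `κ x₀`.
        rw [← tendsto_add_atTop_iff_nat 1]
        have hg : Tendsto (fun n : ℕ => 2 * (L + 2 * B) * α ^ n
            * (1 + β * (W x₀ + ∫ y, W y ∂κ x₀))) atTop (𝓝 0) := by
          have := ((tendsto_pow_atTop_nhds_zero_of_lt_one hα0 hα1).const_mul
            (2 * (L + 2 * B))).mul_const (1 + β * (W x₀ + ∫ y, W y ∂κ x₀))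
          simpa using this
        refine squeeze_zero_norm (fun n => ?_) hg
        rw [Real.norm_eq_abs, hμint _ hfm hB, hμint _ hfm hB, Function.iterate_succ_apply']
        exact θ.abs_integral_iterate_kernelMean_sub_le hβ.le hK hα hα0 hB hL hκi n x₀
      have := (hdiff.comp hφ.tendsto_atTop).add hfl
      rw [zero_add] at this
      refine this.congr fun k => ?_
      simp
    have h2 : Tendsto (fun k => μ (φ k + 1)) atTop (𝓝 π') := by
      refine tendsto_iff_forall_lipschitz_integral_tendsto.2 fun f hf hL => ?_
      obtain ⟨D, hD⟩ := hf
      obtain ⟨L, hL⟩ := hL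
      have hfm := hL.continuous.measurable
      have hB : ∀ x, |f x| ≤ D + |f x₀| := fun x => by
        have := hD x x₀
        rw [Real.dist_eq] at this
        calc |f x| = |(f x - f x₀) + f x₀| := by rw [sub_add_cancel]
          _ ≤ |f x - f x₀| + |f x₀| := abs_add_le _ _
          _ ≤ _ := by linarith
      let F : BoundedContinuousFunction (ℝ≥0 × ℕ) ℝ :=
        BoundedContinuousFunction.ofNormedAddCommGroup (kernelMean κ f)
          (θ.continuous_kernelMean (ε := ε) hβ.le hK hB hL) _ (abs_kernelMean_le κ hB)
      have hF := ProbabilityMeasure.tendsto_iff_forall_integral_tendsto.1 hlim F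
      have e1 : ∫ x, f x ∂(π' : Measure (ℝ≥0 × ℕ)) = ∫ x, F x ∂(π : Measure (ℝ≥0 × ℕ)) :=
        integral_bind_eq_integral_kernelMean κ _ hfm hB
      rw [e1]
      refine hF.congr fun k => ?_
      exact (integral_bind_eq_integral_kernelMean κ (μ (φ k) : Measure (ℝ≥0 × ℕ)) hfm hB).symm
    exact congrArg (fun ρ : ProbabilityMeasure (ℝ≥0 × ℕ) => (ρ : Measure (ℝ≥0 × ℕ)))
      (tendsto_nhds_unique h2 h1)
  have hπM : ∫⁻ x, ENNReal.ofReal (W x) ∂(π : Measure (ℝ≥0 × ℕ)) ≤ M := by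
    refine (lintegral_le_liminf_lintegral_of_forall_isOpen_measure_le_liminf_measure hWc hW0
      fun G hG => ProbabilityMeasure.le_liminf_measure_open_of_tendsto hlim hG).trans ?_
    exact liminf_le_of_le (by isBoundedDefault) fun b hb => by
      obtain ⟨k, hk⟩ := hb.exists
      exact hk.trans (hμM _)
  have hπi : Integrable W (π : Measure (ℝ≥0 × ℕ)) := hint (hπM.trans_lt hM.lt_top)
  refine ⟨π, ε, hε, hinv, hπi, ?_⟩
  refine isStableChain_of_geometric κ π hWm hW0 hdrift ?_
  rintro f ⟨B, hB⟩ ⟨L, hL⟩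
  have hfm := hL.continuous.measurable
  have hB0 : 0 ≤ B := (abs_nonneg _).trans (hB x₀)
  set I := ∫ y, W y ∂(π : Measure (ℝ≥0 × ℕ)) with hI
  have hI0 : 0 ≤ I := integral_nonneg hW0
  -- A positive rate is needed to divide by it, whereas `α` may be 0. The summand `2 * B` below
  -- covers `m = 0`, where no contraction is available.
  set γ := (1 + α) / 2 with hγ
  have hγ0 : 0 < γ := by rw [hγ]; positivity
  have hαγ : α ≤ γ := by rw [hγ]; linarith
  set A := 2 * (L + 2 * B) * (1 + β * (1 + I)) with hA
  have hA0 : 0 ≤ A := by positivity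
  refine ⟨2 * B + A / γ, γ, by positivity, hγ0.le, by rw [hγ]; linarith, fun m x => ?_⟩
  have hfπ : ∀ m, ∫ y, (kernelMean κ)^[m] f y ∂(π : Measure (ℝ≥0 × ℕ))
      = ∫ y, f y ∂(π : Measure (ℝ≥0 × ℕ)) := by
    intro m
    induction m with
    | zero => rfl
    | succ m ih =>
      rw [← ih, Function.iterate_succ_apply']
      conv_rhs => rw [← hinv.def]
      exact (integral_bind_eq_integral_kernelMean κ _ (measurable_iterate_kernelMean κ hfm m)
        (abs_iterate_kernelMean_le κ hB m)).symm
  rw [abs_sub_comm]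
  cases m with
  | zero =>
    have hc : |∫ y, f y ∂(π : Measure (ℝ≥0 × ℕ))| ≤ B := by
      have := norm_integral_le_of_norm_le_const (μ := (π : Measure (ℝ≥0 × ℕ))) (C := B)
        (ae_of_all _ fun y => (Real.norm_eq_abs (f y)).le.trans (hB y))
      simpa using this
    calc |(∫ y, f y ∂(π : Measure (ℝ≥0 × ℕ))) - f x| ≤ 2 * B :=
          (abs_sub _ _).trans (by linarith [hB x])
      _ ≤ (2 * B + A / γ) * γ ^ 0 * W x := by
          rw [pow_zero, mul_one]
          calc 2 * B ≤ 2 * B + A / γ := le_add_of_nonneg_right (by positivity)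
            _ ≤ _ := le_mul_of_one_le_right (by positivity) (hW1 x)
  | succ n =>
    rw [← hfπ (n + 1)]
    refine (θ.abs_integral_iterate_kernelMean_sub_le hβ.le hK hα hα0 hB hL hπi n x).trans ?_
    have h1 : 1 + β * (W x + I) ≤ (1 + β * (1 + I)) * W x := by
      have : β * I ≤ β * I * W x := le_mul_of_one_le_right (by positivity) (hW1 x)
      nlinarith [hW1 x]
    calc 2 * (L + 2 * B) * α ^ n * (1 + β * (W x + I))
        ≤ 2 * (L + 2 * B) * γ ^ n * ((1 + β * (1 + I)) * W x) := by gcongr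
      _ = A / γ * γ ^ (n + 1) * W x := by rw [hA, pow_succ]; field_simp
      _ ≤ (2 * B + A / γ) * γ ^ (n + 1) * W x := by
          have := hW0 x
          gcongr
          exact le_add_of_nonneg_left (by positivity)

end SetparParams

/-! ### Processes indexed by `ℤ` as Markov chains -/

namespace SetparParams

variable (θ : SetparParams)

theorem jointKernel_apply_eq_tsum (x : ℝ≥0 × ℕ) {A : Set (ℝ≥0 × ℕ)} (hA : MeasurableSet A) :
    θ.jointKernel x A
      = ∑' k : ℕ, A.indicator 1 (θ.step x, k) * poissonMeasure (θ.step x) {k} := by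
  rw [← lintegral_indicator_one hA,
    θ.lintegral_jointKernel x (measurable_one.indicator hA), lintegral_countable']

end SetparParams

namespace IsSetpar

variable {Ω : Type*}

/-- The `σ`-algebra of the counts before time `t`. -/
abbrev countPast (Y : ℤ → Ω → ℕ) (t : ℤ) : MeasurableSpace Ω :=
  ⨆ s : {s : ℤ // s ≤ t - 1}, MeasurableSpace.comap (Y s) inferInstance

theorem countPast_mono (Y : ℤ → Ω → ℕ) {s t : ℤ} (hst : s ≤ t) : countPast Y s ≤ countPast Y t :=
  iSup_le fun i => le_iSup (fun j : {j : ℤ // j ≤ t - 1} =>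
    MeasurableSpace.comap (Y j) inferInstance) ⟨i, i.2.trans (by omega)⟩

variable [MeasurableSpace Ω] {θ : SetparParams} {P : Measure Ω}
  {lam : ℤ → Ω → ℝ≥0} {Y : ℤ → Ω → ℕ}

theorem countPast_le (h : IsSetpar θ P lam Y) (t : ℤ) : countPast Y t ≤ ‹MeasurableSpace Ω› :=
  iSup_le fun s => (h.measurable_count s).comap_le

/-- The completed `σ`-algebra of the counts before time `t`. -/
abbrev completedPast (P : Measure Ω) (Y : ℤ → Ω → ℕ) (t : ℤ) : MeasurableSpace Ω :=
  eventuallyMeasurableSpace (countPast Y t) (ae P)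

theorem completedPast_mono (P : Measure Ω) (Y : ℤ → Ω → ℕ) {s t : ℤ} (hst : s ≤ t) :
    completedPast P Y s ≤ completedPast P Y t :=
  fun _ ⟨u, hu, hsu⟩ => ⟨u, countPast_mono Y hst u hu, hsu⟩

theorem measurable_count_completedPast (P : Measure Ω) (Y : ℤ → Ω → ℕ) {s t : ℤ} (hst : s < t) :
    Measurable[completedPast P Y t] (Y s) :=
  Measurable.mono (Measurable.of_comap_le (le_iSup (fun j : {j : ℤ // j ≤ t - 1} =>
    MeasurableSpace.comap (Y j) inferInstance) ⟨s, by omega⟩))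
    (fun _ hs => hs.eventuallyMeasurableSet) le_rfl

/-- The intensity is a function of the past counts: it is read off from the conditional probability
of a vanishing count. -/
theorem measurable_intensity_completedPast (h : IsSetpar θ P lam Y) (t : ℤ) :
    Measurable[completedPast P Y t] (lam t) := by
  set g : Ω → ℝ := P⟦Y t ⁻¹' {0} | countPast Y t⟧ with hg
  have hgm : Measurable[countPast Y t] g := stronglyMeasurable_condExp.measurable
  have hm : Measurable[countPast Y t] fun ω => (-Real.log (g ω)).toNNReal := by fun_prop
  refine hm.eventuallyMeasurable_of_eventuallyEq ?_
  filter_upwards [h.conditional_law t 0] with ω hω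
  rw [hg, hω, poissonMeasure_real_singleton]
  simp

/-- An event of the completed past differs from a past event by a null set, which changes neither
side. -/
theorem measure_inter_preimage_singleton [IsProbabilityMeasure P] (h : IsSetpar θ P lam Y) (t : ℤ)
    (k : ℕ) {s : Set Ω} (hs : MeasurableSet[completedPast P Y t] s) :
    P (s ∩ Y t ⁻¹' {k}) = ∫⁻ ω in s, poissonMeasure (lam t ω) {k} ∂P := by
  obtain ⟨s', hs', hss'⟩ := hs
  rw [Measure.restrict_congr_set hss',
    measure_congr (hss'.inter (EventuallyEq.refl (ae P) (Y t ⁻¹' {k})))]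
  have hB := h.measurable_count t (measurableSet_singleton k)
  have h1 : ∫ ω in s', (Y t ⁻¹' {k}).indicator (fun _ => (1 : ℝ)) ω ∂P
      = ∫ ω in s', (poissonMeasure (lam t ω)).real {k} ∂P := by
    rw [← setIntegral_condExp (h.countPast_le t) ((integrable_const 1).indicator hB) hs']
    exact integral_congr_ae (ae_restrict_of_ae (h.conditional_law t k))
  rw [integral_indicator_const _ hB, smul_eq_mul, mul_one, measureReal_restrict_apply hB] at h1
  have hm : Measurable fun ω => (poissonMeasure (lam t ω)).real {k} :=
    (((Measure.measurable_coe (measurableSet_singleton k)).comp measurable_poissonMeasure).comp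
      (h.measurable_intensity t)).ennreal_toReal
  have hi : Integrable (fun ω => (poissonMeasure (lam t ω)).real {k}) (P.restrict s') :=
    Integrable.of_bound hm.aestronglyMeasurable 1 (ae_of_all _ fun ω => by
      rw [Real.norm_of_nonneg measureReal_nonneg]; exact measureReal_le_one)
  have h2 := ofReal_integral_eq_lintegral_ofReal hi (ae_of_all _ fun ω => measureReal_nonneg)
  rw [← h1, ofReal_measureReal] at h2
  rw [Set.inter_comm, h2]
  exact lintegral_congr fun ω => ofReal_measureReal

/-- Slicing `A` by the value `k` of the count leaves a condition on `lam t`, which belongs to the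
completed past; the conditional law of the count then applies to each slice. -/
theorem measure_inter_preimage [IsProbabilityMeasure P] (h : IsSetpar θ P lam Y) (t : ℤ)
    {s : Set Ω} (hs : MeasurableSet s) (hs' : MeasurableSet[completedPast P Y t] s)
    {A : Set (ℝ≥0 × ℕ)} (hA : MeasurableSet A) :
    P (s ∩ (fun ω => (lam t ω, Y t ω)) ⁻¹' A)
      = ∫⁻ ω in s, θ.jointKernel (lam (t - 1) ω, Y (t - 1) ω) A ∂P := by
  have hAk : ∀ k : ℕ, MeasurableSet {l : ℝ≥0 | (l, k) ∈ A} := fun k =>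
    measurable_prodMk_right hA
  have hcover : s ∩ (fun ω => (lam t ω, Y t ω)) ⁻¹' A
      = ⋃ k : ℕ, (s ∩ lam t ⁻¹' {l | (l, k) ∈ A}) ∩ Y t ⁻¹' {k} := by
    ext ω
    simp only [Set.mem_inter_iff, Set.mem_preimage, Set.mem_iUnion, Set.mem_ofPred_eq,
      Set.mem_singleton_iff]
    constructor
    · rintro ⟨h1, h2⟩
      exact ⟨Y t ω, ⟨h1, h2⟩, rfl⟩
    · rintro ⟨k, ⟨h1, h2⟩, rfl⟩
      exact ⟨h1, h2⟩
  rw [hcover, measure_iUnion]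
  · have hterm : ∀ k : ℕ, P ((s ∩ lam t ⁻¹' {l | (l, k) ∈ A}) ∩ Y t ⁻¹' {k})
        = ∫⁻ ω in s, A.indicator 1 (lam t ω, k) * poissonMeasure (lam t ω) {k} ∂P := by
      intro k
      have hpre : MeasurableSet (lam t ⁻¹' {l | (l, k) ∈ A}) := h.measurable_intensity t (hAk k)
      rw [h.measure_inter_preimage_singleton t k
        (hs'.inter (h.measurable_intensity_completedPast t (hAk k))), Set.inter_comm,
        ← Measure.restrict_restrict hpre, ← lintegral_indicator hpre]
      refine lintegral_congr fun ω => ?_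
      by_cases hω : (lam t ω, k) ∈ A <;> simp [hω, Set.indicator]
    simp_rw [hterm]
    rw [← lintegral_tsum]
    · refine lintegral_congr_ae (ae_restrict_of_ae ?_)
      filter_upwards [h.recursion t] with ω hω
      rw [θ.jointKernel_apply_eq_tsum _ hA]
      simp only [SetparParams.step, ← hω]
    · intro k
      refine Measurable.aemeasurable (Measurable.mul ?_ ?_)
      · exact (measurable_one.indicator hA).comp
          ((h.measurable_intensity t).prodMk measurable_const)
      · exact ((Measure.measurable_coe (measurableSet_singleton k)).comp
          measurable_poissonMeasure).comp (h.measurable_intensity t)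
  · intro i j hij
    refine Set.disjoint_left.2 fun ω h1 h2 => hij ?_
    exact h1.2.symm.trans h2.2
  · intro k
    exact (hs.inter (h.measurable_intensity t (hAk k))).inter
      (h.measurable_count t (measurableSet_singleton k))

/-- A process that follows the model is, from time `0` on, a Markov chain. -/
theorem isMarkovChain [IsProbabilityMeasure P] (h : IsSetpar θ P lam Y) :
    IsMarkovChain θ.jointKernel (P.map fun ω => (lam 0 ω, Y 0 ω)) P
      (fun (n : ℕ) ω => (lam n ω, Y n ω)) := by
  have hX : ∀ n : ℕ, Measurable fun ω => (lam n ω, Y n ω) := fun n =>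
    (h.measurable_intensity n).prodMk (h.measurable_count n)
  refine ⟨hX, rfl, fun n A hA => ?_⟩
  set X : ℕ → Ω → ℝ≥0 × ℕ := fun n ω => (lam n ω, Y n ω) with hXdef
  have hle : (⨆ i : Fin (n + 1), MeasurableSpace.comap (X i) inferInstance)
      ≤ ‹MeasurableSpace Ω› := iSup_le fun i => (hX i).comap_le
  -- The intensities are functions of the past counts only up to null sets, so the past of the pairs
  -- lies in the completed σ-algebra.
  have hle' : (⨆ i : Fin (n + 1), MeasurableSpace.comap (X i) inferInstance)
      ≤ completedPast P Y ((n + 1 : ℕ) : ℤ) := by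
    refine iSup_le fun i => Measurable.comap_le ?_
    have hi : ((i : ℕ) : ℤ) < ((n + 1 : ℕ) : ℤ) := by exact_mod_cast i.2
    exact Measurable.prodMk ((h.measurable_intensity_completedPast _).mono
      (completedPast_mono P Y hi.le) le_rfl) (measurable_count_completedPast P Y hi)
  have hκm : Measurable fun x : ℝ≥0 × ℕ => (θ.jointKernel x).real A :=
    (θ.jointKernel.measurable_coe hA).ennreal_toReal
  have hκi : Integrable (fun ω => (θ.jointKernel (X n ω)).real A) P :=
    Integrable.of_bound (hκm.comp (hX n)).aestronglyMeasurable 1 (ae_of_all _ fun ω => by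
      rw [Real.norm_of_nonneg measureReal_nonneg]; exact measureReal_le_one)
  refine (ae_eq_condExp_of_forall_setIntegral_eq hle
    ((integrable_const 1).indicator (hX (n + 1) hA)) (fun s _ _ => hκi.integrableOn)
    (fun s hs _ => ?_) ?_).symm
  · rw [integral_indicator_const _ (hX (n + 1) hA), smul_eq_mul, mul_one,
      measureReal_restrict_apply (hX (n + 1) hA), Set.inter_comm, measureReal_def,
      h.measure_inter_preimage ((n + 1 : ℕ) : ℤ) (hle s hs) (hle' s hs) hA,
      integral_eq_lintegral_of_nonneg_ae (ae_of_all _ fun ω => measureReal_nonneg)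
        (hκm.comp (hX n)).aestronglyMeasurable]
    congr 1
    refine lintegral_congr fun ω => ?_
    rw [ofReal_measureReal, show ((n + 1 : ℕ) : ℤ) - 1 = n by push_cast; ring]
  · exact (hκm.comp (Measurable.of_comap_le
      (le_iSup (fun j : Fin (n + 1) => MeasurableSpace.comap (X j) inferInstance)
        ⟨n, by omega⟩))).stronglyMeasurable.aestronglyMeasurable

end IsSetpar

/-! ### Identification of the stationary law, and moments -/

/-- An identically distributed stable sequence is distributed according to its stationary law. -/
theorem IsStableSequence.map_eq_of_identDistrib {E : Type*} [MetricSpace E] [MeasurableSpace E]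
    [BorelSpace E] {Ω : Type*} [MeasurableSpace Ω] {P : Measure Ω} [IsProbabilityMeasure P]
    {X : ℕ → Ω → E} {π : ProbabilityMeasure E} (h : IsStableSequence P X π)
    (hX : ∀ n, Measurable (X n)) (hid : ∀ n, IdentDistrib (X n) (X 0) P P) :
    P.map (X 0) = π := by
  let ρ : ProbabilityMeasure E := ⟨P.map (X 0), Measure.isProbabilityMeasure_map (hX 0).aemeasurable⟩
  suffices hρ : Tendsto (fun _ : ℕ => ρ) atTop (𝓝 π) from
    congrArg (fun μ : ProbabilityMeasure E => (μ : Measure E))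
      (tendsto_nhds_unique tendsto_const_nhds hρ)
  refine ProbabilityMeasure.tendsto_iff_forall_integral_tendsto.2 fun f => ?_
  have hfm : Measurable f := f.continuous.measurable
  have hfi : ∀ t, Integrable (fun ω => f (X t ω)) P := fun t =>
    integrable_of_abs_le (hfm.comp (hX t)) fun ω => f.norm_coe_le_norm _
  -- Dominated convergence takes expectations of the empirical averages. By identical distribution
  -- these expectations do not depend on `n`.
  have hlim : Tendsto (fun n => ∫ ω, ∫ x, f x
      ∂(empiricalDistribution (fun t => X t ω) n : Measure E) ∂P) atTop
      (𝓝 (∫ _, ∫ x, f x ∂(π : Measure E) ∂P)) := by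
    refine tendsto_integral_of_dominated_convergence (fun _ => ‖f‖) (fun n => ?_)
      (integrable_const _) (fun n => ae_of_all _ fun ω => ?_) ?_
    · simp_rw [integral_empiricalDistribution _ _ hfm]
      exact ((Finset.measurable_fun_sum _ fun t _ => hfm.comp (hX t)).div_const
        _).aestronglyMeasurable
    · have := norm_integral_le_of_norm_le_const
        (μ := (empiricalDistribution (fun t => X t ω) n : Measure E)) (C := ‖f‖)
        (ae_of_all _ fun x => f.norm_coe_le_norm x)
      simpa using this
    · filter_upwards [h] with ω hω
      exact ProbabilityMeasure.tendsto_iff_forall_integral_tendsto.1 hω f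
  rw [integral_const, probReal_univ, one_smul] at hlim
  refine hlim.congr fun n => ?_
  simp_rw [integral_empiricalDistribution _ _ hfm]
  rw [integral_div, integral_finsetSum _ fun t _ => hfi t]
  have hft : ∀ t, ∫ ω, f (X t ω) ∂P = ∫ x, f x ∂(ρ : Measure E) := fun t => by
    rw [← integral_map (hX t).aemeasurable hfm.aestronglyMeasurable, (hid t).map_eq]
    rfl
  simp_rw [hft]
  rw [Finset.sum_const, Finset.card_range, nsmul_eq_mul]
  have : ((n + 1 : ℕ) : ℝ) ≠ 0 := by positivity
  field_simp

theorem rpow_le_one_add_pow {y s : ℝ} (hy : 0 ≤ y) (hs : 0 ≤ s) : y ^ s ≤ (1 + y) ^ ⌈s⌉₊ := by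
  calc y ^ s ≤ (1 + y) ^ s := Real.rpow_le_rpow hy (by linarith) hs
    _ ≤ (1 + y) ^ ((⌈s⌉₊ : ℕ) : ℝ) :=
        Real.rpow_le_rpow_of_exponent_le (by linarith) (Nat.le_ceil s)
    _ = _ := Real.rpow_natCast _ _

theorem add_pow_le_two_pow_mul {a b : ℝ} (ha : 0 ≤ a) (hb : 0 ≤ b) (k : ℕ) :
    (a + b) ^ k ≤ 2 ^ k * (a ^ k + b ^ k) := by
  rcases le_total a b with h | h
  · calc (a + b) ^ k ≤ (2 * b) ^ k := by gcongr; linarith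
      _ = 2 ^ k * b ^ k := mul_pow _ _ _
      _ ≤ _ := by gcongr; exact le_add_of_nonneg_left (by positivity)
  · calc (a + b) ^ k ≤ (2 * a) ^ k := by gcongr; linarith
      _ = 2 ^ k * a ^ k := mul_pow _ _ _
      _ ≤ _ := by gcongr; exact le_add_of_nonneg_right (by positivity)

/-- The bound `x ^ k ≤ k! exp x` is applied to `x = t (1 + l + y) = 1 + t y`. The choice `t = 1 / (1
+ l)` keeps `l (exp t - 1)` at most 2 for every `l`, whence `exp 3`. -/
theorem lintegral_pow_poissonMeasure_le (l : ℝ≥0) (k : ℕ) :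
    ∫⁻ y : ℕ, ENNReal.ofReal ((1 + l + y) ^ k) ∂poissonMeasure l
      ≤ ENNReal.ofReal (k.factorial * Real.exp 3 * (1 + l) ^ k) := by
  have hl : (0 : ℝ) ≤ l := l.coe_nonneg
  set t : ℝ := 1 / (1 + l) with ht
  have ht0 : 0 < t := by positivity
  have ht1 : t ≤ 1 := by rw [ht, div_le_one (by positivity)]; linarith
  have hlt : l * t ≤ 1 := by rw [ht, mul_one_div, div_le_one (by positivity)]; linarith
  have hexp : Real.exp t - 1 ≤ 2 * t := by
    have := (abs_le.1 (Real.abs_exp_sub_one_sub_id_le (x := t) (by rwa [abs_of_pos ht0]))).2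
    nlinarith
  have hpt : ∀ y : ℕ, (1 + l + y : ℝ) ^ k
      ≤ (k.factorial * (1 + l) ^ k * Real.exp 1) * Real.exp (t * y) := by
    intro y
    have h1 := Real.pow_div_factorial_le_exp (t * (1 + l + y)) (by positivity) k
    have h2 : t * (1 + l + y) = 1 + t * y := by rw [ht]; field_simp
    have h3 : (1 + l + y : ℝ) = (1 + l) * (t * (1 + l + y)) := by rw [ht]; field_simp
    rw [div_le_iff₀ (by positivity)] at h1
    calc (1 + l + y : ℝ) ^ k = (1 + l) ^ k * (t * (1 + l + y)) ^ k := by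
          rw [← mul_pow, ← h3]
      _ ≤ (1 + l) ^ k * (Real.exp (t * (1 + l + y)) * k.factorial) := by gcongr
      _ = _ := by rw [h2, Real.exp_add]; ring
  calc _ ≤ ∫⁻ y : ℕ, ENNReal.ofReal (k.factorial * (1 + l) ^ k * Real.exp 1)
          * ENNReal.ofReal (Real.exp (t * y)) ∂poissonMeasure l := by
        refine lintegral_mono fun y => ?_
        rw [← ENNReal.ofReal_mul (by positivity)]
        exact ENNReal.ofReal_le_ofReal (hpt y)
    _ = ENNReal.ofReal ((k.factorial * (1 + l) ^ k * Real.exp 1)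
          * Real.exp (l * (Real.exp t - 1))) := by
        rw [lintegral_const_mul _ (measurable_of_countable _), lintegral_exp_poissonMeasure,
          ← ENNReal.ofReal_mul (by positivity)]
    _ ≤ _ := by
        refine ENNReal.ofReal_le_ofReal ?_
        rw [mul_assoc, ← Real.exp_add]
        have : Real.exp (1 + l * (Real.exp t - 1)) ≤ Real.exp 3 :=
          Real.exp_le_exp.2 (by nlinarith)
        calc _ ≤ k.factorial * (1 + l : ℝ) ^ k * Real.exp 3 := by gcongr
          _ = _ := by ring

namespace SetparParams

variable (θ : SetparParams)

theorem exists_one_add_step_le :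
    ∃ D : ℝ, 0 ≤ D ∧ ∀ x : ℝ≥0 × ℕ, 1 + (θ.step x : ℝ) ≤ D * (1 + x.1 + x.2) := by
  refine ⟨1 + θ.d₁ + θ.d₂ + θ.a₁ + θ.a₂ + θ.b₁ + θ.b₂, by positivity, fun x => ?_⟩
  have hx1 : (0 : ℝ) ≤ x.1 := x.1.coe_nonneg
  have hx2 : (0 : ℝ) ≤ x.2 := Nat.cast_nonneg _
  have h1 : (0 : ℝ) ≤ θ.d₁ := θ.d₁.coe_nonneg
  have h2 : (0 : ℝ) ≤ θ.d₂ := θ.d₂.coe_nonneg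
  have h3 : (0 : ℝ) ≤ θ.a₁ := θ.a₁.coe_nonneg
  have h4 : (0 : ℝ) ≤ θ.a₂ := θ.a₂.coe_nonneg
  have h5 : (0 : ℝ) ≤ θ.b₁ := θ.b₁.coe_nonneg
  have h6 : (0 : ℝ) ≤ θ.b₂ := θ.b₂.coe_nonneg
  rw [← sub_nonneg]
  unfold step nextIntensity
  split_ifs
  · push_cast
    ring_nf
    positivity
  · push_cast
    ring_nf
    positivity

/-- Moments are needed at each fixed time only, so the constant may exceed 1 and no drift is
required. -/
theorem exists_lintegral_pow_jointKernel_le (k : ℕ) :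
    ∃ C : ℝ, 0 ≤ C ∧ ∀ x : ℝ≥0 × ℕ,
      ∫⁻ z, ENNReal.ofReal ((1 + z.1 + z.2 : ℝ) ^ k) ∂θ.jointKernel x
        ≤ ENNReal.ofReal C * ENNReal.ofReal ((1 + x.1 + x.2 : ℝ) ^ k) := by
  obtain ⟨D, hD, hstep⟩ := θ.exists_one_add_step_le
  refine ⟨k.factorial * Real.exp 3 * D ^ k, by positivity, fun x => ?_⟩
  rw [θ.lintegral_jointKernel x (by fun_prop), ← ENNReal.ofReal_mul (by positivity)]
  refine (lintegral_pow_poissonMeasure_le (θ.step x) k).trans (ENNReal.ofReal_le_ofReal ?_)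
  rw [mul_assoc _ (D ^ k), ← mul_pow]
  have := hstep x
  gcongr

theorem integrable_rpow_of_integrable_exp {ε : ℝ} (hε : 0 < ε) {μ : Measure (ℝ≥0 × ℕ)}
    (hμ : Integrable (fun x => Real.exp (ε * θ.step x)) μ) {s : ℝ} (hs : 0 < s) :
    Integrable (fun x : ℝ≥0 × ℕ => (x.2 : ℝ) ^ s) μ := by
  obtain ⟨c, hc, hstep⟩ := θ.exists_mul_le_step
  set k := ⌈s⌉₊
  set δ := ε * c with hδ
  have hδ0 : 0 < δ := mul_pos hε hc
  refine Integrable.mono' (hμ.const_mul (k.factorial / δ ^ k * Real.exp δ))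
    (Measurable.aestronglyMeasurable (by fun_prop)) (ae_of_all _ fun x => ?_)
  have hy : (0 : ℝ) ≤ x.2 := Nat.cast_nonneg _
  rw [Real.norm_of_nonneg (by positivity)]
  refine (rpow_le_one_add_pow hy hs.le).trans ?_
  have h1 := Real.pow_div_factorial_le_exp (δ * (1 + x.2)) (by positivity) k
  rw [div_le_iff₀ (by positivity), mul_pow] at h1
  have h2 : Real.exp (δ * (1 + x.2)) ≤ Real.exp δ * Real.exp (ε * θ.step x) := by
    rw [← Real.exp_add, Real.exp_le_exp]
    have h3 : c * x.2 ≤ θ.step x := by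
      have := hstep x
      have := mul_nonneg hc.le x.1.coe_nonneg
      linarith
    have := mul_le_mul_of_nonneg_left h3 hε.le
    rw [hδ]
    linarith
  calc (1 + x.2 : ℝ) ^ k = (δ ^ k * (1 + x.2) ^ k) / δ ^ k := by field_simp
    _ ≤ (Real.exp δ * Real.exp (ε * θ.step x) * k.factorial) / δ ^ k := by
        refine div_le_div_of_nonneg_right (h1.trans ?_) (by positivity)
        gcongr
    _ = _ := by ring

/-- Moments of all orders propagate along the chain. -/
theorem integrable_rpow_of_isMarkovChain {ν : Measure (ℝ≥0 × ℕ)} [IsProbabilityMeasure ν]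
    (hν : ∀ s : ℝ, 0 < s → Integrable (fun x : ℝ≥0 × ℕ => (x.1 : ℝ) ^ s) ν ∧
      Integrable (fun x : ℝ≥0 × ℕ => (x.2 : ℝ) ^ s) ν)
    {Ω : Type*} [MeasurableSpace Ω] {P : Measure Ω} [IsProbabilityMeasure P]
    {X : ℕ → Ω → ℝ≥0 × ℕ} (h : IsMarkovChain θ.jointKernel ν P X) (t : ℕ) {s : ℝ} (hs : 0 < s) :
    Integrable (fun ω => ((X t ω).2 : ℝ) ^ s) P := by
  set k := ⌈s⌉₊
  have hk0 : 0 < k := Nat.ceil_pos.2 hs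
  -- Both coordinates enter, because the next intensity depends on both.
  set H : ℝ≥0 × ℕ → ℝ := fun x => (1 + x.1 + x.2) ^ k with hH
  have hHm : Measurable H := by rw [hH]; fun_prop
  have hH0 : ∀ x, 0 ≤ H x := fun x => by positivity
  have hinit : Integrable H ν := by
    obtain ⟨i1, i2⟩ := hν k (by exact_mod_cast hk0)
    simp only [Real.rpow_natCast] at i1 i2
    have hdom : Integrable (fun x : ℝ≥0 × ℕ =>
        (2 : ℝ) ^ k * (2 ^ k * (1 + (x.1 : ℝ) ^ k) + (x.2 : ℝ) ^ k)) ν :=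
      ((((integrable_const (1 : ℝ)).add i1).const_mul (2 ^ k)).add i2).const_mul (2 ^ k)
    refine hdom.mono' hHm.aestronglyMeasurable (ae_of_all _ fun x => ?_)
    have hx1 : (0 : ℝ) ≤ x.1 := x.1.coe_nonneg
    have hx2 : (0 : ℝ) ≤ x.2 := Nat.cast_nonneg _
    rw [Real.norm_of_nonneg (hH0 x)]
    have h1 := add_pow_le_two_pow_mul (show (0 : ℝ) ≤ 1 + x.1 by positivity) hx2 k
    have h2 := add_pow_le_two_pow_mul zero_le_one hx1 k
    rw [one_pow] at h2
    exact h1.trans (by gcongr)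
  obtain ⟨C, hC, hCκ⟩ := θ.exists_lintegral_pow_jointKernel_le k
  have hfin : ∀ t, ∫⁻ x, ENNReal.ofReal (H x) ∂(P.map (X t)) < ∞ := by
    intro t
    induction t with
    | zero =>
      rw [h.initial, ← hasFiniteIntegral_iff_ofReal (ae_of_all _ hH0)]
      exact hinit.2
    | succ t ih =>
      have hstep := h.map_restrict_succ (n := t) MeasurableSet.univ
      rw [Measure.restrict_univ] at hstep
      rw [hstep, Measure.lintegral_bind θ.jointKernel.aemeasurable
        hHm.ennreal_ofReal.aemeasurable]
      refine (lintegral_mono hCκ).trans_lt ?_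
      rw [lintegral_const_mul _ hHm.ennreal_ofReal]
      exact ENNReal.mul_lt_top ENNReal.ofReal_lt_top ih
  have hHi : Integrable (fun ω => H (X t ω)) P := by
    refine ⟨(hHm.comp (h.measurable t)).aestronglyMeasurable, ?_⟩
    rw [hasFiniteIntegral_iff_ofReal (ae_of_all _ fun ω => hH0 _)]
    have := hfin t
    rwa [lintegral_map hHm.ennreal_ofReal (h.measurable t)] at this
  have hm : Measurable fun x : ℝ≥0 × ℕ => (x.2 : ℝ) ^ s := by fun_prop
  refine hHi.mono' (hm.comp (h.measurable t)).aestronglyMeasurable (ae_of_all _ fun ω => ?_)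
  have hx1 : (0 : ℝ) ≤ (X t ω).1 := (X t ω).1.coe_nonneg
  have hx2 : (0 : ℝ) ≤ (X t ω).2 := Nat.cast_nonneg _
  rw [Real.norm_of_nonneg (by positivity)]
  refine (rpow_le_one_add_pow hx2 hs.le).trans ?_
  exact pow_le_pow_left₀ (by positivity) (by linarith) k

end SetparParams

theorem corollary1 (θ : SetparParams) (ha₁ : θ.a₁ < 1) (hab₂ : θ.a₂ + θ.b₂ < 1) :
    ∃ π : ProbabilityMeasure (ℝ≥0 × ℕ),
      -- the joint chain `(λ_t, Y_t)` is stable, and its stationary distribution is invariant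
      IsStableChain.{u, 0} θ.jointKernel π ∧
      Kernel.Invariant θ.jointKernel (π : Measure (ℝ≥0 × ℕ)) ∧
      -- under the stationary distribution the count has finite moments of all orders
      (∀ s : ℝ, 0 < s →
        Integrable (fun x : ℝ≥0 × ℕ => (x.2 : ℝ) ^ s) (π : Measure (ℝ≥0 × ℕ))) ∧
      -- every process that follows the model is stable with stationary distribution `π`, and its
      -- counts have finite moments of all orders when `(λ_t, Y_t)` is identically distributed
      (∀ (Ω : Type u) [MeasurableSpace Ω] (P : Measure Ω) [IsProbabilityMeasure P]
        (lam : ℤ → Ω → ℝ≥0) (Y : ℤ → Ω → ℕ), IsSetpar θ P lam Y →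
        IsStableSequence P (fun (n : ℕ) ω => (lam n ω, Y n ω)) π ∧
        ((∀ t, IdentDistrib (fun ω => (lam t ω, Y t ω)) (fun ω => (lam 0 ω, Y 0 ω)) P P) →
          ∀ (t : ℤ) (s : ℝ), 0 < s → Integrable (fun ω => (Y t ω : ℝ) ^ s) P)) ∧
      -- the same moments are finite for the chain started from any initial distribution that has
      -- finite moments of all orders, in particular from any fixed initial value
      (∀ (ν : Measure (ℝ≥0 × ℕ)) [IsProbabilityMeasure ν],
        (∀ s : ℝ, 0 < s → Integrable (fun x : ℝ≥0 × ℕ => (x.1 : ℝ) ^ s) ν ∧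
          Integrable (fun x : ℝ≥0 × ℕ => (x.2 : ℝ) ^ s) ν) →
        ∀ (Ω : Type u) [MeasurableSpace Ω] (P : Measure Ω) [IsProbabilityMeasure P]
          (X : ℕ → Ω → ℝ≥0 × ℕ), IsMarkovChain θ.jointKernel ν P X →
          ∀ (t : ℕ) (s : ℝ), 0 < s → Integrable (fun ω => ((X t ω).2 : ℝ) ^ s) P) := by
  obtain ⟨π, ε, hε, hinv, hexp, hstable⟩ := θ.exists_invariant_isStableChain ha₁ hab₂
  have hπ : ∀ s : ℝ, 0 < s →
      Integrable (fun x : ℝ≥0 × ℕ => (x.2 : ℝ) ^ s) (π : Measure (ℝ≥0 × ℕ)) :=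
    fun s hs => θ.integrable_rpow_of_integrable_exp hε hexp hs
  refine ⟨π, hstable, hinv, hπ, fun Ω _ P _ lam Y h => ?_, ?_⟩
  · have hX : ∀ t, Measurable fun ω => (lam t ω, Y t ω) := fun t =>
      (h.measurable_intensity t).prodMk (h.measurable_count t)
    have := Measure.isProbabilityMeasure_map (μ := P) (hX 0).aemeasurable
    have hseq := hstable _ Ω P _ h.isMarkovChain
    refine ⟨hseq, fun hid t s hs => ?_⟩
    -- Stability identifies the common law of the pairs with `π`, so the moments of `π` transfer.
    have hlaw : P.map (fun ω => (lam t ω, Y t ω)) = π :=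
      (hid t).map_eq.trans (hseq.map_eq_of_identDistrib (fun n => hX n) fun n => hid n)
    have hi := hπ s hs
    rw [← hlaw] at hi
    exact hi.comp_measurable (hX t)
  · intro ν _ hν Ω _ P _ X h t s hs
    exact θ.integrable_rpow_of_isMarkovChain hν h t hs
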